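/- Let $n\ge 0$, $[n]=\{1,\dots,n\}$ and $X,Y\subseteq\mathbb N$. For $\sigma=\sigma_1\cdots\sigma_n\in S_n$ let $\mathrm{des}_{X,Y}(\sigma)$ be the number of $i$ with $\sigma_i>\sigma_{i+1}$, $\sigma_i\in X$, $\sigma_{i+1}\in Y$; let $P_{n,s}^{X,Y}$ be the number of $\sigma\in S_n$ with $\mathrm{des}_{X,Y}(\sigma)=s$, and $P_{n,s}^{X}=P_{n,s}^{X,\mathbb N}$. A board is a finite set of squares $(i,j)$ (row $i$, numbered from the top; column $j$, numbered from the left). The rook number $r_k(B)$ is the number of sets of $k$ squares of $B$ no two of which are in the same row or column; boards are rook-equivalent if all their rook numbers agree. For $B\subseteq[n]\times[n]$, the hit number $h_s(B)$ is the number of placements of $n$ non-attacking rooks on $[n]\times[n]$ with exactly $s$ rooks on $B$. A Ferrers board is a board of partition shape; if it fits into $[n]\times[n]$ we draw it right justified in the bottom right corner, longest row at the bottom. Let $B_n^{X,Y}=\{(i,j)\in[n]\times[n]: i\in X,\ j\in Y,\ j<i\}$. Shifting its non-empty rows and columns to the bottom left until there are no gaps, and taking the mirror image, gives a Ferrers board,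 called the Ferrers board of $(X,Y)$; the Ferrers board of $X'$ is that of $(X',\mathbb N)$. Foata's first transformation $\Phi$ sends $\omega\in S_n$ to the word obtained by writing each cycle of $\omega$ with its largest element last, ordering the cycles by increasing largest element, reversing each cycle and erasing the parentheses. **Proposition.** 1. $\Phi$ is a bijection $S_n\to S_n$; letters $a,b$ form a descent pair of $\Phi(\omega)$ (that is, $a>b$ and $a$ stands immediately before $b$) if and only if $\omega(b)=a>b$; and $\mathrm{des}_{X,Y}(\Phi(\omega))$ is the number of $j\in[n]$ with $(\omega(j),j)\in B_n^{X,Y}$. 2. Let $B$ be the Ferrers board of $(X,Y)$. It fits into $[n]\times[n]$ and is rook-equivalent to $B_n^{X,Y}$, and $P_{n,s}^{X,Y}=h_s(B_n^{X,Y})=h_s(B)$ for all $s$. 3. There is a unique Ferrers board $B'$ whose non-empty rows have distinct lengths and which is rook-equivalent to $B$. It fits into $[n]\times[n]$, and $P_{n,s}^{X,Y}=h_s(B')$ for all $s$. 4. There is a unique set $X'\subseteq\{2,\dots,n\}$ whose Ferrers board is $B'$. For every $X'\subseteq[n]$ whose Ferrers board is $B'$ (the only other possibility being to add the element $1$, which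 is irrelevant), $$P_{n,s}^{X,Y}=P_{n,s}^{X'}=h_s(B')\qquad\text{for all } s .$$ -/

import Mathlib

namespace DescentRook

/-! Permutations of `[n] = {1, …, n}` are elements of `Equiv.Perm (Fin n)`; the element `a : Fin n`
stands for the integer `a + 1`, and `σ` for the word `σ 0 + 1, σ 1 + 1, …, σ (n - 1) + 1`. -/

/-- `(a, b)` is a descent pair of `σ`: the letters `a > b` stand next to each other, in this order,
in the word of `σ`. -/
def IsDescentPair {n : ℕ} (σ : Equiv.Perm (Fin n)) (a b : Fin n) : Prop :=
  ∃ i j : Fin n, (j : ℕ) = (i : ℕ) + 1 ∧ σ i = a ∧ σ j = b ∧ b < a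

open Classical in
/-- The set of (positions of the) `X,Y`-descents of `σ`. -/
noncomputable def DesXY {n : ℕ} (X Y : Set ℕ) (σ : Equiv.Perm (Fin n)) : Finset (Fin n) :=
  Finset.univ.filter fun i => ∃ j : Fin n, (j : ℕ) = (i : ℕ) + 1 ∧ σ j < σ i ∧
    (σ i : ℕ) + 1 ∈ X ∧ (σ j : ℕ) + 1 ∈ Y

/-- The number of `X,Y`-descents of `σ`. -/
noncomputable def desXY {n : ℕ} (X Y : Set ℕ) (σ : Equiv.Perm (Fin n)) : ℕ :=
  (DesXY X Y σ).card

open Classical in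
/-- `P n s X Y`: the number of permutations of `[n]` with exactly `s` `X,Y`-descents. -/
noncomputable def P (n s : ℕ) (X Y : Set ℕ) : ℕ :=
  (Finset.univ.filter fun σ : Equiv.Perm (Fin n) => desXY X Y σ = s).card

/-- The word of Foata's first transformation of `ω`. The cycles of `ω` are ordered by increasing
largest element; the cycle with largest element `m` contributes the block
`m, ω⁻¹ m, ω⁻² m, …` (the cycle written with `m` last, then reversed). -/
def foataWord {n : ℕ} (ω : Equiv.Perm (Fin n)) : List (Fin n) :=
  ((List.finRange n).filter fun m => decide (∀ k : Fin n, ω.SameCycle m k → k ≤ m)).flatMap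
    fun m => (List.range (Finset.univ.filter fun k : Fin n => ω.SameCycle m k).card).map
      fun k => (ω⁻¹ ^ k) m

/-- A board is a finite set of squares `(row, column)`. Rows are numbered from top to bottom and
columns from left to right. -/
abbrev Board : Type := Finset (ℕ × ℕ)

/-- No two squares of `R` lie in the same row or in the same column. -/
def NonAttacking (R : Board) : Prop :=
  ∀ c ∈ R, ∀ d ∈ R, c ≠ d → c.1 ≠ d.1 ∧ c.2 ≠ d.2

instance (R : Board) : Decidable (NonAttacking R) := by
  unfold NonAttacking; infer_instance

/-- The rook number `r_k(B)`. -/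
def rookNumber (k : ℕ) (B : Board) : ℕ :=
  ((B.powersetCard k).filter fun R => NonAttacking R).card

/-- Two boards are rook-equivalent if they have the same rook numbers. -/
def RookEquivalent (B C : Board) : Prop := ∀ k : ℕ, rookNumber k B = rookNumber k C

/-- The `n × n` board, with rows and columns numbered from `1` to `n`. -/
def square (n : ℕ) : Board := Finset.Icc 1 n ×ˢ Finset.Icc 1 n

/-- The hit number `h_s(B)` of a board `B` contained in the `n × n` board. -/
def hitNumber (n s : ℕ) (B : Board) : ℕ :=
  (((square n).powersetCard n).filter fun R => NonAttacking R ∧ (R ∩ B).card = s).card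

/-- The placement of `n` rooks given by `ω`: in column `j` the rook stands in row `ω j`. -/
def rooks {n : ℕ} (ω : Equiv.Perm (Fin n)) : Board :=
  Finset.univ.image fun j : Fin n => ((ω j : ℕ) + 1, (j : ℕ) + 1)

open Classical in
/-- The board `B_n^{X,Y}` of the potential `X,Y`-descent pairs `(i, j)` of permutations of `[n]`. -/
noncomputable def descentBoard (n : ℕ) (X Y : Set ℕ) : Board :=
  (square n).filter fun c => c.1 ∈ X ∧ c.2 ∈ Y ∧ c.2 < c.1

/-- Shift the non-empty rows of `B` down and its non-empty columns to the left until there are no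
gaps. The result is given in coordinates counted from the bottom left corner, from `0` on: first
the row (upwards), then the column (to the right). -/
def shiftToCorner (B : Board) : Board :=
  B.image fun c => (((B.image Prod.fst).filter fun i => c.1 < i).card,
    ((B.image Prod.snd).filter fun j => j < c.2).card)

theorem exists_card_gt (S : Finset ℕ) (a d : ℕ) : ∀ x ∈ S,
    (S.filter fun i => x < i).card = a + d →
      ∃ y ∈ S, x ≤ y ∧ (S.filter fun i => y < i).card = a := by
  induction d with
  | zero => exact fun x hx h => ⟨x, hx, le_rfl, h⟩
  | succ d ih =>
    intro x hx h
    have hne : (S.filter fun i => x < i).Nonempty := by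
      rw [← Finset.card_pos]; omega
    set m := (S.filter fun i => x < i).min' hne with hm
    have hmem := Finset.min'_mem _ hne
    rw [← hm, Finset.mem_filter] at hmem
    have heq : (S.filter fun i => m < i) = (S.filter fun i => x < i).erase m := by
      ext i
      simp only [Finset.mem_filter, Finset.mem_erase]
      constructor
      · rintro ⟨h1, h2⟩
        exact ⟨h2.ne', h1, hmem.2.trans h2⟩
      · rintro ⟨h1, h2, h3⟩
        exact ⟨h2, lt_of_le_of_ne
          (Finset.min'_le _ _ (Finset.mem_filter.2 ⟨h2, h3⟩)) (Ne.symm h1)⟩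
    obtain ⟨y, hy, hmy, hc⟩ := ih m hmem.1 (by
      rw [heq, Finset.card_erase_of_mem (Finset.mem_filter.2 hmem), h]; rfl)
    exact ⟨y, hy, hmem.2.le.trans hmy, hc⟩

theorem exists_card_lt (S : Finset ℕ) (a d : ℕ) : ∀ x ∈ S,
    (S.filter fun i => i < x).card = a + d →
      ∃ y ∈ S, y ≤ x ∧ (S.filter fun i => i < y).card = a := by
  induction d with
  | zero => exact fun x hx h => ⟨x, hx, le_rfl, h⟩
  | succ d ih =>
    intro x hx h
    have hne : (S.filter fun i => i < x).Nonempty := by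
      rw [← Finset.card_pos]; omega
    set m := (S.filter fun i => i < x).max' hne with hm
    have hmem := Finset.max'_mem _ hne
    rw [← hm, Finset.mem_filter] at hmem
    have heq : (S.filter fun i => i < m) = (S.filter fun i => i < x).erase m := by
      ext i
      simp only [Finset.mem_filter, Finset.mem_erase]
      constructor
      · rintro ⟨h1, h2⟩
        exact ⟨h2.ne, h1, h2.trans hmem.2⟩
      · rintro ⟨h1, h2, h3⟩
        exact ⟨h2, lt_of_le_of_ne
          (Finset.le_max' _ _ (Finset.mem_filter.2 ⟨h2, h3⟩)) h1⟩
    obtain ⟨y, hy, hmy, hc⟩ := ih m hmem.1 (by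
      rw [heq, Finset.card_erase_of_mem (Finset.mem_filter.2 hmem), h]; rfl)
    exact ⟨y, hy, hmy.trans hmem.2.le, hc⟩

/-- The Ferrers board of `B_n^{X,Y}`: its non-empty rows and columns are shifted to the corner.
A Ferrers board (up to its place in the plane) is a Young diagram; row `0` is the longest one. -/
noncomputable def ferrersBoard (n : ℕ) (X Y : Set ℕ) : YoungDiagram where
  cells := shiftToCorner (descentBoard n X Y)
  isLowerSet := by
    rintro ⟨a, b⟩ ⟨a', b'⟩ ⟨ha, hb⟩ hc
    simp only [shiftToCorner, Finset.coe_image, Set.mem_image, Finset.mem_coe] at hc ⊢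
    obtain ⟨⟨i, j⟩, hij, he⟩ := hc
    rw [Prod.mk.injEq] at he
    obtain ⟨i', hi', hii, hi⟩ := exists_card_gt _ a' (a - a') i
      (Finset.mem_image_of_mem Prod.fst hij)
      (he.1.trans (Nat.add_sub_cancel' (show a' ≤ a from ha)).symm)
    obtain ⟨j', hj', hjj, hj⟩ := exists_card_lt _ b' (b - b') j
      (Finset.mem_image_of_mem Prod.snd hij)
      (he.2.trans (Nat.add_sub_cancel' (show b' ≤ b from hb)).symm)
    refine ⟨(i', j'), ?_, Prod.ext hi hj⟩
    obtain ⟨⟨p, q⟩, hpq, rfl⟩ := Finset.mem_image.1 hi'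
    obtain ⟨⟨u, v⟩, huv, rfl⟩ := Finset.mem_image.1 hj'
    simp only [descentBoard, square, Finset.mem_filter, Finset.mem_product, Finset.mem_Icc]
      at hij hpq huv hii hjj ⊢
    exact ⟨⟨hpq.1.1, huv.1.2⟩, hpq.2.1, huv.2.2.1, by omega⟩

/-- The Ferrers board `B` fits into the `n × n` board. -/
def Fits (n : ℕ) (B : YoungDiagram) : Prop :=
  B.cells ⊆ Finset.range n ×ˢ Finset.range n

/-- The Ferrers board `B`, right justified in the bottom right corner of the `n × n` board
(used only where `B` fits). -/
def inSquare (n : ℕ) (B : YoungDiagram) : Board :=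
  B.cells.image fun c => (n - c.1, n - c.2)

/-- The (non-empty) rows of the Ferrers board `B` have distinct lengths. -/
def DistinctRows (B : YoungDiagram) : Prop :=
  ∀ i j : ℕ, 0 < B.rowLen i → B.rowLen i = B.rowLen j → i = j

end DescentRook

namespace DescentRook

open Polynomial

/-! ### Rook numbers and hit numbers -/

/-! Three facts are combined. Foata: in the block `m, ω⁻¹ m, ω⁻² m, …` each letter is the `ω`-image
of the next one, and at a boundary between blocks the word ascends, because the last letter of a
block is at most its top, which is less than the next top. So the descent pairs of `Φ ω` are exactly
the pairs `(ω b, b)` with `ω b > b`, that is, rooks of `ω` below the diagonal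
(`isDescentPair_iff_of_ofFn_eq`). Cutting a word at its left-to-right maxima recovers the blocks,
hence `Φ` is injective. This makes `P` a hit number. Hit numbers depend only on rook numbers:
counting pairs of a `k`-rook placement on `B` and a permutation extending it gives the binomial
moments `(n - k)! r_k(B)` of the number of hits (`sum_choose_card_rooks_inter`), and these determine
its distribution. Ferrers boards: by the Goldman–Joichi–White factorization the rook numbers amount
to the multiset of the values `rowLen i + i` for `i < N` (`rookEquivalent_cells_iff`). For distinct
rows these values weakly decrease along the `m` non-empty rows, and the empty rows contribute `m, …,
N - 1`, where `m` is the minimum of the multiset. Hence the multiset determines the board.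
Conversely, for any Ferrers board the sequence `rowLen i + i` climbs by at most one per step, so it
contains every value from its minimum up to `N - 1`; one copy of each is set aside for the empty
rows, and the remaining values, sorted, give the distinct rows. The staircase bound `rowLen i + i <
n` on non-empty rows holds for the board of `(X, Y)` and survives this construction; thus `B'` fits,
and its row lengths plus one form a set in `[2, n]`, which is `X'`. -/

theorem NonAttacking.mono {R S : Board} (h : R ⊆ S) (hS : NonAttacking S) : NonAttacking R :=
  fun c hc d hd => hS c (h hc) d (h hd)

theorem NonAttacking.injOn_fst {R : Board} (h : NonAttacking R) :
    Set.InjOn Prod.fst (R : Set (ℕ × ℕ)) := fun c hc d hd e => by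
  by_contra hne
  exact (h c hc d hd hne).1 e

theorem NonAttacking.injOn_snd {R : Board} (h : NonAttacking R) :
    Set.InjOn Prod.snd (R : Set (ℕ × ℕ)) := fun c hc d hd e => by
  by_contra hne
  exact (h c hc d hd hne).2 e

/-- Rook numbers are not changed by moving rows and columns. -/
theorem rookNumber_image (B : Board) (f g : ℕ → ℕ)
    (hf : ∀ c ∈ B, ∀ d ∈ B, f c.1 = f d.1 → c.1 = d.1)
    (hg : ∀ c ∈ B, ∀ d ∈ B, g c.2 = g d.2 → c.2 = d.2) (k : ℕ) :
    rookNumber k (B.image fun c => (f c.1, g c.2)) = rookNumber k B := by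
  set φ : ℕ × ℕ → ℕ × ℕ := fun c => (f c.1, g c.2) with hφ
  have hinj : Set.InjOn φ (B : Set (ℕ × ℕ)) := fun c hc d hd e => by
    simp only [hφ, Prod.mk.injEq] at e
    exact Prod.ext (hf c hc d hd e.1) (hg c hc d hd e.2)
  symm
  unfold rookNumber
  refine Finset.card_bij (fun R _ => R.image φ) ?_ ?_ ?_
  · intro R hR
    simp only [Finset.mem_filter, Finset.mem_powersetCard] at hR ⊢
    obtain ⟨⟨hRB, hk⟩, hna⟩ := hR
    refine ⟨⟨Finset.image_subset_image hRB, ?_⟩, ?_⟩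
    · rw [Finset.card_image_of_injOn (hinj.mono hRB), hk]
    · intro c hc d hd hne
      obtain ⟨c, hcR, rfl⟩ := Finset.mem_image.1 hc
      obtain ⟨d, hdR, rfl⟩ := Finset.mem_image.1 hd
      have := hna c hcR d hdR (fun e => hne (e ▸ rfl))
      exact ⟨fun e => this.1 (hf c (hRB hcR) d (hRB hdR) e),
        fun e => this.2 (hg c (hRB hcR) d (hRB hdR) e)⟩
  · intro R hR S hS e
    simp only [Finset.mem_filter, Finset.mem_powersetCard] at hR hS
    have e' : φ '' (R : Set (ℕ × ℕ)) = φ '' (S : Set (ℕ × ℕ)) := by exact_mod_cast e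
    exact_mod_cast (hinj.image_eq_image_iff (by exact_mod_cast hR.1.1)
      (by exact_mod_cast hS.1.1)).1 e'
  · intro S hS
    simp only [Finset.mem_filter, Finset.mem_powersetCard] at hS
    obtain ⟨⟨hSB, hk⟩, hna⟩ := hS
    obtain ⟨R, hR, rfl⟩ := Finset.subset_image_iff.1 hSB
    have hRB : R ⊆ B := by exact_mod_cast hR
    refine ⟨R, ?_, rfl⟩
    simp only [Finset.mem_filter, Finset.mem_powersetCard]
    refine ⟨⟨hRB, ?_⟩, ?_⟩
    · rw [← hk, Finset.card_image_of_injOn (hinj.mono hRB)]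
    · intro c hc d hd hne
      have := hna (φ c) (Finset.mem_image_of_mem _ hc) (φ d) (Finset.mem_image_of_mem _ hd)
        (fun e => hne (hinj (hRB hc) (hRB hd) e))
      exact ⟨fun e => this.1 (by simp [hφ, e]), fun e => this.2 (by simp [hφ, e])⟩

theorem mem_rooks {n : ℕ} (ω : Equiv.Perm (Fin n)) (c : ℕ × ℕ) :
    c ∈ rooks ω ↔ ∃ j : Fin n, ((ω j : ℕ) + 1, (j : ℕ) + 1) = c := by
  simp [rooks]

theorem card_rooks {n : ℕ} (ω : Equiv.Perm (Fin n)) : (rooks ω).card = n := by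
  rw [rooks, Finset.card_image_of_injective _ ?_, Finset.card_univ, Fintype.card_fin]
  intro i j h
  simp only [Prod.mk.injEq, add_left_inj] at h
  exact Fin.ext h.2

theorem nonAttacking_rooks {n : ℕ} (ω : Equiv.Perm (Fin n)) : NonAttacking (rooks ω) := by
  intro c hc d hd hne
  obtain ⟨i, rfl⟩ := (mem_rooks ω c).1 hc
  obtain ⟨j, rfl⟩ := (mem_rooks ω d).1 hd
  have hij : i ≠ j := fun e => hne (e ▸ rfl)
  constructor
  · simpa [Fin.val_inj] using hij
  · simpa [Fin.val_inj] using hij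

theorem rooks_subset_square {n : ℕ} (ω : Equiv.Perm (Fin n)) : rooks ω ⊆ square n := by
  intro c hc
  obtain ⟨i, rfl⟩ := (mem_rooks ω c).1 hc
  simp only [square, Finset.mem_product, Finset.mem_Icc]
  omega

theorem rooks_injective {n : ℕ} : Function.Injective (rooks (n := n)) := by
  intro ω τ h
  ext j
  have : ((ω j : ℕ) + 1, (j : ℕ) + 1) ∈ rooks τ := h ▸ (mem_rooks ω _).2 ⟨j, rfl⟩
  obtain ⟨i, hi⟩ := (mem_rooks τ _).1 this
  simp only [Prod.mk.injEq, add_left_inj] at hi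
  obtain rfl : i = j := Fin.ext hi.2
  exact hi.1.symm

/-- A partial placement is part of the rooks of a permutation. -/
theorem NonAttacking.exists_rooks {n : ℕ} {R : Board} (hR : NonAttacking R) (h : R ⊆ square n) :
    ∃ ω : Equiv.Perm (Fin n), R ⊆ rooks ω := by
  classical
  have hsq : ∀ c ∈ R, (1 ≤ c.1 ∧ c.1 ≤ n) ∧ 1 ≤ c.2 ∧ c.2 ≤ n := fun c hc => by
    simpa [square] using h hc
  have hex : ∀ j : {j : Fin n // ∃ c ∈ R, c.2 = (j : ℕ) + 1},
      ∃ i : Fin n, ((i : ℕ) + 1, (j : ℕ) + 1) ∈ R := by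
    rintro ⟨j, c, hc, hj⟩
    have := hsq c hc
    refine ⟨⟨c.1 - 1, by omega⟩, ?_⟩
    convert hc using 1
    ext <;> simp <;> omega
  choose f hf using hex
  have hinj : Function.Injective f := fun a b e => by
    have h1 := hf a
    rw [e] at h1
    have := congrArg Prod.snd (hR.injOn_fst h1 (hf b) rfl)
    simp only [add_left_inj] at this
    exact Subtype.ext (Fin.ext this)
  -- The rooks match occupied columns with occupied rows; any such partial matching extends to a
  -- permutation.
  let e : {j : Fin n // ∃ c ∈ R, c.2 = (j : ℕ) + 1} ≃ {i : Fin n // i ∈ Set.range f} :=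
    Equiv.ofInjective f hinj
  refine ⟨e.extendSubtype, fun c hc => (mem_rooks _ c).2 ?_⟩
  have := hsq c hc
  have hj : ∃ d ∈ R, d.2 = ((⟨c.2 - 1, by omega⟩ : Fin n) : ℕ) + 1 :=
    ⟨c, hc, by simp only; omega⟩
  refine ⟨⟨c.2 - 1, by omega⟩, ?_⟩
  rw [Equiv.extendSubtype_apply_of_mem e _ hj]
  refine hR.injOn_snd (hf _) hc ?_
  simp only; omega

/-- The number of permutations whose rooks contain a given partial placement. -/
theorem card_filter_subset_rooks {n : ℕ} {R : Board} (hR : NonAttacking R) (h : R ⊆ square n) :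
    (Finset.univ.filter fun ω : Equiv.Perm (Fin n) => R ⊆ rooks ω).card =
      (n - R.card).factorial := by
  classical
  obtain ⟨τ, hτ⟩ := hR.exists_rooks h
  set S : Finset (Fin n) := Finset.univ.filter fun j => ((τ j : ℕ) + 1, (j : ℕ) + 1) ∈ R with hS
  have hcard : S.card = R.card := by
    refine Finset.card_bij (fun j _ => ((τ j : ℕ) + 1, (j : ℕ) + 1)) (fun j hj => by
      simpa [hS] using hj) (fun i _ j _ e => ?_) (fun c hc => ?_)
    · simp only [Prod.mk.injEq, add_left_inj] at e
      exact Fin.ext e.2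
    · obtain ⟨j, rfl⟩ := (mem_rooks τ c).1 (hτ hc)
      exact ⟨j, by simpa [hS] using hc, rfl⟩
  have hiff : ∀ ω : Equiv.Perm (Fin n), R ⊆ rooks ω ↔ ∀ j ∈ S, ω j = τ j := by
    intro ω
    constructor
    · intro hω j hj
      obtain ⟨i, hi⟩ := (mem_rooks ω _).1 (hω (by simpa [hS] using hj))
      simp only [Prod.mk.injEq, add_left_inj] at hi
      obtain rfl : i = j := Fin.ext hi.2
      exact Fin.ext hi.1
    · intro hω c hc
      obtain ⟨j, rfl⟩ := (mem_rooks τ c).1 (hτ hc)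
      exact (mem_rooks ω _).2 ⟨j, by rw [hω j (by simpa [hS] using hc)]⟩
  -- Composing with `τ⁻¹` turns the extensions of `R` into the permutations fixing `S` pointwise,
  -- that is, the permutations of the complement of `S`.
  have e1 : (Finset.univ.filter fun ω : Equiv.Perm (Fin n) => R ⊆ rooks ω).card =
      Fintype.card {π : Equiv.Perm (Fin n) // ∀ j, ¬ (j ∉ S) → π j = j} := by
    rw [Fintype.card_subtype]
    refine Finset.card_bij (fun ω _ => τ⁻¹ * ω) ?_ ?_ ?_
    · intro ω hω
      simp only [Finset.mem_filter, Finset.mem_univ, true_and, hiff, not_not] at hω ⊢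
      intro j hj
      rw [Equiv.Perm.mul_apply, hω j hj]
      exact τ.symm_apply_apply j
    · intro ω _ ω' _ e
      exact mul_left_cancel e
    · intro π hπ
      simp only [Finset.mem_filter, Finset.mem_univ, true_and, not_not] at hπ
      refine ⟨τ * π, ?_, by simp⟩
      simp only [Finset.mem_filter, Finset.mem_univ, true_and, hiff]
      intro j hj
      rw [Equiv.Perm.mul_apply, hπ j hj]
  rw [e1, ← Fintype.card_congr (Equiv.Perm.subtypeEquivSubtypePerm fun j => j ∉ S),
    Fintype.card_perm, ← hcard]
  congr 1
  rw [Fintype.card_subtype_compl]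
  simp

theorem hitNumber_eq_card_perm (n s : ℕ) (B : Board) :
    hitNumber n s B =
      (Finset.univ.filter fun ω : Equiv.Perm (Fin n) => (rooks ω ∩ B).card = s).card := by
  symm
  unfold hitNumber
  refine Finset.card_bij (fun ω _ => rooks ω) ?_ (fun ω _ τ _ e => rooks_injective e) ?_
  · intro ω hω
    simp only [Finset.mem_filter, Finset.mem_univ, true_and, Finset.mem_powersetCard] at hω ⊢
    exact ⟨⟨rooks_subset_square ω, card_rooks ω⟩, nonAttacking_rooks ω, hω⟩
  · intro R hR
    simp only [Finset.mem_filter, Finset.mem_powersetCard] at hR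
    obtain ⟨ω, hω⟩ := hR.2.1.exists_rooks hR.1.1
    obtain rfl : R = rooks ω :=
      Finset.eq_of_subset_of_card_le hω (by rw [card_rooks, hR.1.2])
    exact ⟨ω, by simpa using hR.2.2, rfl⟩

/-- Double count of the pairs `(ω, R)` with `R` a `k`-rook placement on `B` contained in `rooks ω`.
-/
theorem sum_choose_card_rooks_inter (n k : ℕ) {B : Board} (hB : B ⊆ square n) :
    ∑ ω : Equiv.Perm (Fin n), ((rooks ω ∩ B).card).choose k =
      (n - k).factorial * rookNumber k B := by
  classical
  have h1 : ∀ ω : Equiv.Perm (Fin n), ((rooks ω ∩ B).card).choose k =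
      ∑ R ∈ (B.powersetCard k).filter (fun R => NonAttacking R),
        if R ⊆ rooks ω then 1 else 0 := by
    intro ω
    rw [← Finset.card_powersetCard, Finset.sum_boole, Nat.cast_id, Finset.filter_filter]
    congr 1
    ext R
    simp only [Finset.mem_powersetCard, Finset.mem_filter, Finset.subset_inter_iff]
    constructor
    · rintro ⟨⟨h1, h2⟩, h3⟩
      exact ⟨⟨h2, h3⟩, (nonAttacking_rooks ω).mono h1, h1⟩
    · rintro ⟨⟨h2, h3⟩, -, h1⟩
      exact ⟨⟨h1, h2⟩, h3⟩
  simp_rw [h1]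
  rw [Finset.sum_comm]
  have h2 : ∀ R ∈ (B.powersetCard k).filter (fun R => NonAttacking R),
      (∑ ω : Equiv.Perm (Fin n), if R ⊆ rooks ω then 1 else 0) = (n - k).factorial := by
    intro R hR
    simp only [Finset.mem_filter, Finset.mem_powersetCard] at hR
    rw [Finset.sum_boole, Nat.cast_id, card_filter_subset_rooks hR.2 (hR.1.1.trans hB), hR.1.2]
  rw [Finset.sum_congr rfl h2, Finset.sum_const, smul_eq_mul, rookNumber, mul_comm]

/-- The distribution of a statistic is determined by its binomial moments. -/
theorem card_filter_eq_of_sum_choose {ι : Type*} [Fintype ι] (a b : ι → ℕ)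
    (h : ∀ k, ∑ i, (a i).choose k = ∑ i, (b i).choose k) (s : ℕ) :
    (Finset.univ.filter fun i => a i = s).card = (Finset.univ.filter fun i => b i = s).card := by
  -- The binomial moments are the coefficients of `∑ (X + 1) ^ a i`; substituting `X - 1` for `X`
  -- leaves `∑ X ^ a i`, whose coefficients count the fibres.
  have h1 : ∑ i, (X + 1 : ℤ[X]) ^ a i = ∑ i, (X + 1 : ℤ[X]) ^ b i := by
    ext k
    simp only [finsetSum_coeff, coeff_X_add_one_pow]
    exact_mod_cast h k
  have h2 := congrArg (fun p : ℤ[X] => (p.comp (X - 1)).coeff s) h1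
  simp only [Polynomial.sum_comp, pow_comp, add_comp, X_comp, one_comp, sub_add_cancel,
    finsetSum_coeff, coeff_X_pow] at h2
  simp only [Finset.sum_boole, eq_comm (a := s)] at h2
  exact_mod_cast h2

/-- Rook-equivalent boards in the same square have the same hit numbers. -/
theorem RookEquivalent.hitNumber_eq {n : ℕ} {B C : Board} (h : RookEquivalent B C)
    (hB : B ⊆ square n) (hC : C ⊆ square n) (s : ℕ) : hitNumber n s B = hitNumber n s C := by
  rw [hitNumber_eq_card_perm, hitNumber_eq_card_perm]
  refine card_filter_eq_of_sum_choose _ _ (fun k => ?_) s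
  rw [sum_choose_card_rooks_inter n k hB, sum_choose_card_rooks_inter n k hC, h k]


/-! ### Foata's first transformation -/

/-- The block of `m` in the word of Foata's transformation. -/
def foataBlock {n : ℕ} (ω : Equiv.Perm (Fin n)) (m : Fin n) : List (Fin n) :=
  (List.range (Finset.univ.filter fun k : Fin n => ω.SameCycle m k).card).map
    fun k => (ω⁻¹ ^ k) m

/-- The largest elements of the cycles, in increasing order. -/
def cycleTops {n : ℕ} (ω : Equiv.Perm (Fin n)) : List (Fin n) :=
  (List.finRange n).filter fun m => decide (∀ k : Fin n, ω.SameCycle m k → k ≤ m)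

theorem foataWord_eq {n : ℕ} (ω : Equiv.Perm (Fin n)) :
    foataWord ω = ((cycleTops ω).map (foataBlock ω)).flatten := rfl

theorem mem_cycleTops {n : ℕ} {ω : Equiv.Perm (Fin n)} {m : Fin n} :
    m ∈ cycleTops ω ↔ ∀ k : Fin n, ω.SameCycle m k → k ≤ m := by
  simp [cycleTops]

theorem pairwise_cycleTops {n : ℕ} (ω : Equiv.Perm (Fin n)) :
    (cycleTops ω).Pairwise (· < ·) :=
  (List.pairwise_lt_finRange n).filter _

theorem minimalPeriod_pos {n : ℕ} (ω : Equiv.Perm (Fin n)) (m : Fin n) :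
    0 < Function.minimalPeriod (⇑ω⁻¹) m :=
  Function.minimalPeriod_pos_of_mem_periodicPts
    (Function.Injective.mem_periodicPts (ω⁻¹).injective m)

theorem sameCycle_iff_exists_lt {n : ℕ} (ω : Equiv.Perm (Fin n)) (m k : Fin n) :
    ω.SameCycle m k ↔ ∃ i < Function.minimalPeriod (⇑ω⁻¹) m, (ω⁻¹ ^ i) m = k := by
  constructor
  · intro h
    obtain ⟨i, hi⟩ := (Equiv.Perm.sameCycle_inv.2 h).exists_nat_pow_eq
    refine ⟨i % Function.minimalPeriod (⇑ω⁻¹) m, Nat.mod_lt _ (minimalPeriod_pos ω m), ?_⟩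
    rw [← hi, ← Equiv.Perm.iterate_eq_pow, ← Equiv.Perm.iterate_eq_pow,
      Function.iterate_mod_minimalPeriod_eq]
  · rintro ⟨i, -, hi⟩
    exact Equiv.Perm.sameCycle_inv.1 ⟨i, by simpa using hi⟩

/-- With the minimal period as block length, the powers of `ω⁻¹` in a block run through the cycle
exactly once. -/
theorem card_sameCycle {n : ℕ} (ω : Equiv.Perm (Fin n)) (m : Fin n) :
    (Finset.univ.filter fun k : Fin n => ω.SameCycle m k).card =
      Function.minimalPeriod (⇑ω⁻¹) m := by
  have h : (Finset.univ.filter fun k : Fin n => ω.SameCycle m k) =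
      (Finset.range (Function.minimalPeriod (⇑ω⁻¹) m)).image fun i => (ω⁻¹ ^ i) m := by
    ext k
    simp [sameCycle_iff_exists_lt]
  rw [h, Finset.card_image_of_injOn, Finset.card_range]
  intro i hi j hj e
  simp only [← Equiv.Perm.iterate_eq_pow] at e
  exact Function.iterate_injOn_Iio_minimalPeriod (by simpa using hi) (by simpa using hj) e

theorem foataBlock_eq {n : ℕ} (ω : Equiv.Perm (Fin n)) (m : Fin n) :
    foataBlock ω m =
      (List.range (Function.minimalPeriod (⇑ω⁻¹) m)).map fun k => (ω⁻¹ ^ k) m := by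
  rw [foataBlock, card_sameCycle]

theorem mem_foataBlock {n : ℕ} {ω : Equiv.Perm (Fin n)} {m k : Fin n} :
    k ∈ foataBlock ω m ↔ ω.SameCycle m k := by
  simp [foataBlock_eq, sameCycle_iff_exists_lt]

theorem nodup_foataBlock {n : ℕ} (ω : Equiv.Perm (Fin n)) (m : Fin n) :
    (foataBlock ω m).Nodup := by
  rw [foataBlock_eq]
  refine List.Nodup.map_on (fun i hi j hj e => ?_) List.nodup_range
  simp only [← Equiv.Perm.iterate_eq_pow] at e
  exact Function.iterate_injOn_Iio_minimalPeriod (by simpa using hi) (by simpa using hj) e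

theorem foataBlock_eq_cons {n : ℕ} (ω : Equiv.Perm (Fin n)) (m : Fin n) :
    ∃ t, foataBlock ω m = m :: t := by
  rw [foataBlock_eq]
  obtain ⟨p, hp⟩ := Nat.exists_eq_succ_of_ne_zero (minimalPeriod_pos ω m).ne'
  rw [hp, List.range_succ_eq_map]
  exact ⟨_, rfl⟩

theorem eq_of_sameCycle_of_mem_cycleTops {n : ℕ} {ω : Equiv.Perm (Fin n)} {a b : Fin n}
    (ha : a ∈ cycleTops ω) (hb : b ∈ cycleTops ω) (h : ω.SameCycle a b) : a = b :=
  le_antisymm (mem_cycleTops.1 hb _ h.symm) (mem_cycleTops.1 ha _ h)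

theorem exists_mem_cycleTops {n : ℕ} (ω : Equiv.Perm (Fin n)) (x : Fin n) :
    ∃ m ∈ cycleTops ω, ω.SameCycle m x := by
  obtain ⟨m, hm, hmax⟩ := Finset.exists_max_image
    (Finset.univ.filter fun k : Fin n => ω.SameCycle x k) id ⟨x, by simpa using Equiv.Perm.SameCycle.refl ω x⟩
  simp only [Finset.mem_filter, Finset.mem_univ, true_and, id] at hm hmax
  exact ⟨m, mem_cycleTops.2 fun k hk => hmax k (hm.trans hk), hm.symm⟩

theorem mem_foataWord {n : ℕ} (ω : Equiv.Perm (Fin n)) (x : Fin n) : x ∈ foataWord ω := by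
  obtain ⟨m, hm, hx⟩ := exists_mem_cycleTops ω x
  rw [foataWord_eq, List.mem_flatten]
  exact ⟨_, List.mem_map_of_mem hm, mem_foataBlock.2 hx⟩

theorem nodup_foataWord {n : ℕ} (ω : Equiv.Perm (Fin n)) : (foataWord ω).Nodup := by
  rw [foataWord_eq, List.nodup_flatten]
  constructor
  · intro l hl
    obtain ⟨m, -, rfl⟩ := List.mem_map.1 hl
    exact nodup_foataBlock ω m
  · rw [List.pairwise_map]
    refine (pairwise_cycleTops ω).imp_of_mem fun {a b} ha hb hab => ?_
    intro x hxa hxb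
    exact hab.ne (eq_of_sameCycle_of_mem_cycleTops ha hb
      ((mem_foataBlock.1 hxa).trans (mem_foataBlock.1 hxb).symm))

theorem length_foataWord {n : ℕ} (ω : Equiv.Perm (Fin n)) : (foataWord ω).length = n := by
  rw [← List.toFinset_card_of_nodup (nodup_foataWord ω),
    Finset.eq_univ_iff_forall.2 fun x => List.mem_toFinset.2 (mem_foataWord ω x),
    Finset.card_univ, Fintype.card_fin]

/-- A list of blocks, each starting with its largest element, with increasing first elements,
is determined by its concatenation. -/
theorem eq_of_flatten_eq {α : Type*} [LinearOrder α] :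
    ∀ L M : List (List α),
      (∀ l ∈ L, ∃ m t, l = m :: t ∧ ∀ x ∈ t, x ≤ m) →
      (∀ l ∈ M, ∃ m t, l = m :: t ∧ ∀ x ∈ t, x ≤ m) →
      L.Pairwise (fun l l' => ∀ m ∈ l.head?, ∀ m' ∈ l'.head?, m < m') →
      M.Pairwise (fun l l' => ∀ m ∈ l.head?, ∀ m' ∈ l'.head?, m < m') →
      L.flatten = M.flatten → L = M
  | [], [], _, _, _, _, _ => rfl
  | [], l :: M, _, h, _, _, e => by
    obtain ⟨m, t, rfl, -⟩ := h l (by simp)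
    simp at e
  | l :: L, [], h, _, _, _, e => by
    obtain ⟨m, t, rfl, -⟩ := h l (by simp)
    simp at e
  | l :: L, l' :: M, hL, hM, pL, pM, e => by
    obtain ⟨m, t, rfl, ht⟩ := hL l (by simp)
    obtain ⟨m', t', rfl, ht'⟩ := hM l' (by simp)
    simp only [List.flatten_cons, List.cons_append, List.cons.injEq] at e
    obtain ⟨rfl, e⟩ := e
    rw [List.pairwise_cons] at pL pM
    -- The first block ends just before the first letter exceeding its head `m`: such a letter, if
    -- any, is the head of the next block.
    have key : ∀ (t : List α) (L : List (List α)), (∀ x ∈ t, x ≤ m) →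
        (∀ l ∈ L, ∃ m t, l = m :: t ∧ ∀ x ∈ t, x ≤ m) →
        (∀ l' ∈ L, ∀ m₁ ∈ (m :: t).head?, ∀ m' ∈ l'.head?, m₁ < m') →
        (t ++ L.flatten).takeWhile (fun x => decide (x ≤ m)) = t := by
      intro t L ht hL hp
      rw [List.takeWhile_append_of_pos (by simpa using ht)]
      cases L with
      | nil => simp
      | cons l L =>
        obtain ⟨m₂, t₂, rfl, -⟩ := hL l (by simp)
        have := hp (m₂ :: t₂) (by simp) m (by simp) m₂ (by simp)
        simp [this]
    have h1 := key t L ht (fun l hl => hL l (by simp [hl])) pL.1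
    have h2 := key t' M ht' (fun l hl => hM l (by simp [hl])) pM.1
    obtain rfl : t = t' := by rw [← h1, ← h2, e]
    rw [List.append_cancel_left_eq] at e
    rw [eq_of_flatten_eq L M (fun l hl => hL l (by simp [hl])) (fun l hl => hM l (by simp [hl]))
      pL.2 pM.2 e]

/-- The word determines its blocks, and the block of `m` lists the orbit of `m` under `ω⁻¹` in
order, so `ω⁻¹` can be read off. -/
theorem foataWord_injective {n : ℕ} : Function.Injective (foataWord (n := n)) := by
  intro ω τ h
  have h1 : ∀ ω : Equiv.Perm (Fin n), ∀ l ∈ (cycleTops ω).map (foataBlock ω),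
      ∃ m t, l = m :: t ∧ ∀ x ∈ t, x ≤ m := by
    intro ω l hl
    obtain ⟨m, hm, rfl⟩ := List.mem_map.1 hl
    obtain ⟨t, ht⟩ := foataBlock_eq_cons ω m
    exact ⟨m, t, ht, fun x hx => mem_cycleTops.1 hm x (mem_foataBlock.1 (by rw [ht]; simp [hx]))⟩
  have hhead : ∀ (ω : Equiv.Perm (Fin n)) m, (foataBlock ω m).head? = some m := by
    intro ω m
    obtain ⟨t, ht⟩ := foataBlock_eq_cons ω m
    rw [ht, List.head?_cons]
  have h2 : ∀ ω : Equiv.Perm (Fin n), ((cycleTops ω).map (foataBlock ω)).Pairwise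
      (fun l l' => ∀ m ∈ l.head?, ∀ m' ∈ l'.head?, m < m') := by
    intro ω
    rw [List.pairwise_map]
    refine (pairwise_cycleTops ω).imp fun {a b} hab => ?_
    simpa [hhead] using hab
  have h3 := eq_of_flatten_eq _ _ (h1 ω) (h1 τ) (h2 ω) (h2 τ) h
  have h4 : cycleTops ω = cycleTops τ := by
    have := congrArg (List.map List.head?) h3
    simp only [List.map_map, Function.comp_def, hhead] at this
    exact List.map_injective_iff.2 (Option.some_injective _) this
  rw [← h4] at h3
  rw [← inv_inj]
  ext1 x
  obtain ⟨m, hm, hx⟩ := exists_mem_cycleTops ω x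
  have h5 := List.map_inj_left.1 h3 m hm
  rw [foataBlock_eq, foataBlock_eq] at h5
  have hp : Function.minimalPeriod (⇑ω⁻¹) m = Function.minimalPeriod (⇑τ⁻¹) m := by
    simpa using congrArg List.length h5
  rw [← hp, List.map_inj_left] at h5
  -- The endpoint `i = minimalPeriod` is included, where both sides return to `m`; it gives the
  -- value of the inverse at the last letter of the block.
  have h6 : ∀ i ≤ Function.minimalPeriod (⇑ω⁻¹) m, (ω⁻¹ ^ i) m = (τ⁻¹ ^ i) m := by
    intro i hi
    rcases hi.lt_or_eq with hi | rfl
    · exact h5 i (by simpa using hi)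
    · conv_rhs => rw [hp]
      rw [← Equiv.Perm.iterate_eq_pow, ← Equiv.Perm.iterate_eq_pow,
        Function.iterate_minimalPeriod, Function.iterate_minimalPeriod]
  obtain ⟨i, hi, rfl⟩ := (sameCycle_iff_exists_lt ω m x).1 hx
  have h7 := h6 (i + 1) hi
  rw [pow_succ', pow_succ', Equiv.Perm.mul_apply, Equiv.Perm.mul_apply, ← h6 i hi.le] at h7
  exact h7

/-- Inside a block the relation holds by construction; between blocks there is an ascent, so the
condition is vacuous. -/
theorem isChain_foataWord {n : ℕ} (ω : Equiv.Perm (Fin n)) :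
    (foataWord ω).IsChain fun a b => b < a → ω b = a := by
  rw [foataWord_eq, List.isChain_flatten]
  · constructor
    · intro l hl
      obtain ⟨m, -, rfl⟩ := List.mem_map.1 hl
      rw [foataBlock_eq, List.isChain_iff_getElem]
      intro i hi _
      simp only [List.getElem_map, List.getElem_range, pow_succ']
      exact ω.apply_symm_apply _
    · rw [List.isChain_map]
      refine ((pairwise_cycleTops ω).imp_of_mem fun {a b} ha hb hab => ?_).isChain
      intro x hx y hy hyx
      obtain ⟨t, ht⟩ := foataBlock_eq_cons ω b
      rw [ht, List.head?_cons, Option.mem_def, Option.some_inj] at hy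
      have := mem_cycleTops.1 ha x (mem_foataBlock.1 (List.mem_of_mem_getLast? hx))
      subst hy
      exact absurd (hyx.trans_le this) hab.not_gt
  · intro h
    obtain ⟨m, -, h⟩ := List.mem_map.1 h
    obtain ⟨t, ht⟩ := foataBlock_eq_cons ω m
    simp [ht] at h

/-- As `ω b > b`, the letter `b` is not the top of its cycle, so it has a predecessor in its block,
namely `ω b`. -/
theorem infix_foataWord {n : ℕ} {ω : Equiv.Perm (Fin n)} {b : Fin n} (h : b < ω b) :
    [ω b, b] <:+: foataWord ω := by
  obtain ⟨m, hm, hb⟩ := exists_mem_cycleTops ω b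
  have h1 : foataBlock ω m <:+: foataWord ω := by
    rw [foataWord_eq]
    obtain ⟨s, t, hst⟩ := List.append_of_mem (List.mem_map_of_mem (f := foataBlock ω) hm)
    rw [hst]
    exact ⟨s.flatten, t.flatten, by simp⟩
  refine List.IsInfix.trans ?_ h1
  obtain ⟨i, hi, hib⟩ := (sameCycle_iff_exists_lt ω m b).1 hb
  cases i with
  | zero =>
    obtain rfl : m = b := by simpa using hib
    exact absurd h (mem_cycleTops.1 hm _ ⟨1, by simp⟩).not_gt
  | succ i =>
    have h2 : (ω⁻¹ ^ i) m = ω b := by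
      rw [← hib, pow_succ', Equiv.Perm.mul_apply]
      exact (ω.apply_symm_apply _).symm
    rw [foataBlock_eq]
    obtain ⟨d, hd⟩ := Nat.exists_eq_add_of_le (Nat.succ_le_of_lt hi)
    refine ⟨(List.range i).map fun k => (ω⁻¹ ^ k) m,
      (List.range d).map fun k => (ω⁻¹ ^ (i + 2 + k)) m, ?_⟩
    rw [hd, List.range_add, List.map_append, List.map_map, List.range_succ, List.range_succ]
    simp only [List.map_append, List.map_singleton, h2, hib, List.append_assoc, Function.comp_def]
    rfl

theorem exists_foata (n : ℕ) : ∃ Φ : Equiv.Perm (Fin n) ≃ Equiv.Perm (Fin n),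
    ∀ ω, List.ofFn (Φ ω) = foataWord ω := by
  have h : ∀ ω : Equiv.Perm (Fin n), ∃ σ : Equiv.Perm (Fin n), List.ofFn σ = foataWord ω := by
    intro ω
    have hl := length_foataWord ω
    let f : Fin n → Fin n := fun i => (foataWord ω).get (i.cast hl.symm)
    have hf : List.ofFn f = foataWord ω := by
      refine List.ext_getElem (by simp [hl]) fun i h1 h2 => by simp [f]
    have hinj : Function.Injective f :=
      (List.nodup_iff_injective_get.1 (nodup_foataWord ω)).comp (Fin.cast_injective _)
    exact ⟨Equiv.ofBijective f (Finite.injective_iff_bijective.1 hinj), hf⟩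
  choose F hF using h
  have hinj : Function.Injective F := fun ω τ e => foataWord_injective (by rw [← hF, ← hF, e])
  exact ⟨Equiv.ofBijective F (Finite.injective_iff_bijective.1 hinj), hF⟩

theorem isDescentPair_iff_of_ofFn_eq {n : ℕ} {σ ω : Equiv.Perm (Fin n)}
    (h : List.ofFn σ = foataWord ω) (a b : Fin n) :
    IsDescentPair σ a b ↔ b < a ∧ ω b = a := by
  constructor
  · rintro ⟨i, j, hij, rfl, rfl, hlt⟩
    refine ⟨hlt, ?_⟩
    have hc := isChain_foataWord ω
    rw [← h, List.isChain_iff_getElem] at hc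
    have := hc i (by simp; omega)
    simp only [List.getElem_ofFn] at this
    have hj : (⟨(i : ℕ) + 1, by omega⟩ : Fin n) = j := Fin.ext hij.symm
    rw [hj] at this
    exact this hlt
  · rintro ⟨hlt, rfl⟩
    obtain ⟨s, t, hst⟩ := infix_foataWord hlt
    rw [← h] at hst
    have hlen : s.length + 2 + t.length = n := by
      have := congrArg List.length hst
      simp at this
      omega
    refine ⟨⟨s.length, by omega⟩, ⟨s.length + 1, by omega⟩, rfl, ?_, ?_, hlt⟩
    · have h1 : (List.ofFn σ)[s.length]? = some (ω b) := by simp [← hst]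
      rw [List.getElem?_ofFn] at h1
      simpa [show s.length < n by omega] using h1
    · have h1 : (List.ofFn σ)[s.length + 1]? = some b := by simp [← hst]
      rw [List.getElem?_ofFn] at h1
      simpa [show s.length + 1 < n by omega] using h1

/-! ### Descents as rooks on the descent board -/

theorem mem_descentBoard {n : ℕ} {X Y : Set ℕ} {c : ℕ × ℕ} :
    c ∈ descentBoard n X Y ↔
      ((1 ≤ c.1 ∧ c.1 ≤ n) ∧ 1 ≤ c.2 ∧ c.2 ≤ n) ∧ c.1 ∈ X ∧ c.2 ∈ Y ∧ c.2 < c.1 := by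
  simp [descentBoard, square]

theorem desXY_eq_card_of_isDescentPair_iff {n : ℕ} {σ ω : Equiv.Perm (Fin n)}
    (h : ∀ a b, IsDescentPair σ a b ↔ b < a ∧ ω b = a) (X Y : Set ℕ) :
    desXY X Y σ = (rooks ω ∩ descentBoard n X Y).card := by
  classical
  have hD : ∀ i, i ∈ DesXY X Y σ ↔ ∃ j : Fin n, (j : ℕ) = (i : ℕ) + 1 ∧ σ j < σ i ∧
    (σ i : ℕ) + 1 ∈ X ∧ (σ j : ℕ) + 1 ∈ Y := fun i => by simp [DesXY]
  -- The column is the letter following `σ i`; writing it as `ω⁻¹ (σ i)` makes it depend on `i`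
  -- alone.
  refine Finset.card_bij (fun i _ => ((σ i : ℕ) + 1, (ω⁻¹ (σ i) : ℕ) + 1)) ?_ ?_ ?_
  · intro i hi
    obtain ⟨j, hj, hlt, hX, hY⟩ := (hD i).1 hi
    have h1 := ((h _ _).1 ⟨i, j, hj, rfl, rfl, hlt⟩).2
    rw [Finset.mem_inter, mem_descentBoard]
    have h2 : ω⁻¹ (σ i) = σ j := ω.symm_apply_eq.2 h1.symm
    refine ⟨?_, ?_⟩
    · simp only [rooks, Finset.mem_image, Finset.mem_univ, true_and]
      exact ⟨σ j, by rw [h1, h2]⟩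
    · simp only [h2]
      have := (σ i).isLt
      have := (σ j).isLt
      have : (σ j : ℕ) < σ i := hlt
      exact ⟨by omega, hX, hY, by omega⟩
  · intro i _ j _ e
    simp only [Prod.mk.injEq, add_left_inj] at e
    exact σ.injective (Fin.ext e.1)
  · intro c hc
    rw [Finset.mem_inter, mem_descentBoard] at hc
    obtain ⟨hc, -, hX, hY, hlt⟩ := hc
    simp only [rooks, Finset.mem_image, Finset.mem_univ, true_and] at hc
    obtain ⟨b, rfl⟩ := hc
    obtain ⟨i, j, hij, hi, hj, hba⟩ := (h (ω b) b).2 ⟨by simpa using hlt, rfl⟩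
    refine ⟨i, (hD i).2 ⟨j, hij, ?_, ?_, ?_⟩, ?_⟩
    · rw [hi, hj]; exact hba
    · rw [hi]; exact hX
    · rw [hj]; exact hY
    · simp [hi]


/-! ### The factorization of the rook polynomial of a Ferrers board -/

theorem rookNumber_zero (B : Board) : rookNumber 0 B = 1 := by
  rw [rookNumber, Finset.powersetCard_zero, Finset.filter_singleton,
    if_pos (show NonAttacking ∅ from fun c hc => absurd hc (Finset.notMem_empty c)), Finset.card_singleton]

/-- The effect on the rook numbers of adding a new row which is at least as long as the others. -/
theorem rookNumber_succ_union_row (C : Board) (i L k : ℕ) (hi : ∀ c ∈ C, c.1 ≠ i)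
    (hL : ∀ c ∈ C, c.2 < L) :
    (rookNumber (k + 1) (C ∪ {i} ×ˢ Finset.range L) : ℤ) =
      rookNumber (k + 1) C + (L - k) * rookNumber k C := by
  classical
  set D : Board := C ∪ {i} ×ˢ Finset.range L with hD
  set G := fun (k : ℕ) (B : Board) => (B.powersetCard k).filter fun R => NonAttacking R with hG
  have hmemG : ∀ k B R, R ∈ G k B ↔ (R ⊆ B ∧ R.card = k) ∧ NonAttacking R := fun k B R => by
    simp [hG, Finset.mem_powersetCard]
  have hmemD : ∀ c, c ∈ D ↔ c ∈ C ∨ (c.1 = i ∧ c.2 < L) := fun c => by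
    rw [hD, Finset.mem_union, Finset.mem_product, Finset.mem_singleton, Finset.mem_range]
  have h1 : (G (k + 1) D).filter (fun R => R ⊆ C) = G (k + 1) C := by
    ext R
    simp only [Finset.mem_filter, hmemG]
    exact ⟨fun h => ⟨⟨h.2, h.1.1.2⟩, h.1.2⟩,
      fun h => ⟨⟨⟨h.1.1.trans Finset.subset_union_left, h.1.2⟩, h.2⟩, h.1.1⟩⟩
  -- A placement using the new row is a `k`-rook placement on `C` together with a free column of
  -- that row.
  have h2 : ((G k C).sigma fun R => Finset.range L \ R.image Prod.snd).card =
      ((G (k + 1) D).filter fun R => ¬ R ⊆ C).card := by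
    refine Finset.card_bij (fun p _ => insert (i, p.2) p.1) ?_ ?_ ?_
    · rintro ⟨R, b⟩ hp
      simp only [Finset.mem_sigma, hmemG, Finset.mem_sdiff, Finset.mem_range,
        Finset.mem_image, not_exists, not_and] at hp
      obtain ⟨⟨⟨hRC, hk⟩, hna⟩, hb, hbR⟩ := hp
      have hiR : (i, b) ∉ R := fun h => hi _ (hRC h) rfl
      simp only [Finset.mem_filter, hmemG]
      refine ⟨⟨⟨?_, ?_⟩, ?_⟩, ?_⟩
      · intro c hc
        rcases Finset.mem_insert.1 hc with rfl | hc
        · exact (hmemD _).2 (Or.inr ⟨rfl, hb⟩)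
        · exact (hmemD _).2 (Or.inl (hRC hc))
      · rw [Finset.card_insert_of_notMem hiR, hk]
      · intro c hc d hd hne
        rcases Finset.mem_insert.1 hc with rfl | hc <;> rcases Finset.mem_insert.1 hd with rfl | hd
        · exact absurd rfl hne
        · exact ⟨(hi d (hRC hd)).symm, fun e => hbR d hd e.symm⟩
        · exact ⟨hi c (hRC hc), hbR c hc⟩
        · exact hna c hc d hd hne
      · intro h
        exact hi _ (h (Finset.mem_insert_self _ _)) rfl
    · rintro ⟨R, b⟩ hp ⟨S, b'⟩ hq e
      simp only [Finset.mem_sigma, hmemG] at hp hq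
      have hR : ∀ x, (i, x) ∉ R := fun x h => hi _ (hp.1.1.1 h) rfl
      have hS : ∀ x, (i, x) ∉ S := fun x h => hi _ (hq.1.1.1 h) rfl
      simp only at e
      have hb : b = b' := by
        have h3 : (i, b) ∈ insert (i, b') S := e ▸ Finset.mem_insert_self _ _
        rcases Finset.mem_insert.1 h3 with h | h
        · exact congrArg Prod.snd h
        · exact absurd h (hS b)
      subst hb
      have : R = S := by
        rw [← Finset.erase_insert (hR b), e, Finset.erase_insert (hS b)]
      subst this
      rfl
    · intro R hR
      simp only [Finset.mem_filter, hmemG] at hR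
      obtain ⟨⟨⟨hRD, hk⟩, hna⟩, hn⟩ := hR
      obtain ⟨⟨i', b⟩, hc, hcC⟩ := Finset.not_subset.1 hn
      obtain ⟨rfl, hb⟩ := ((hmemD _).1 (hRD hc)).resolve_left hcC
      refine ⟨⟨R.erase (i', b), b⟩, ?_, Finset.insert_erase hc⟩
      simp only [Finset.mem_sigma, hmemG, Finset.mem_sdiff, Finset.mem_range,
        Finset.mem_image, not_exists, not_and]
      refine ⟨⟨⟨?_, ?_⟩, hna.mono (Finset.erase_subset _ _)⟩, hb, ?_⟩
      · intro c hc'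
        rw [Finset.mem_erase] at hc'
        refine ((hmemD c).1 (hRD hc'.2)).resolve_right fun h => ?_
        exact hc'.1 (hna.injOn_fst hc'.2 hc h.1)
      · rw [Finset.card_erase_of_mem hc, hk, Nat.add_sub_cancel]
      · intro c hc' e
        rw [Finset.mem_erase] at hc'
        exact hc'.1 (hna.injOn_snd hc'.2 hc e)
  -- All `k` columns of `R` lie below `L`. If `k > L` there is no such `R`, so a negative factor `L
  -- - k` does no harm.
  have h3 : ∀ R ∈ G k C, ((Finset.range L \ R.image Prod.snd).card : ℤ) = L - k := by
    intro R hR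
    rw [hmemG] at hR
    have hsub : R.image Prod.snd ⊆ Finset.range L := by
      intro b hb
      obtain ⟨c, hc, rfl⟩ := Finset.mem_image.1 hb
      exact Finset.mem_range.2 (hL c (hR.1.1 hc))
    have hcard : (R.image Prod.snd).card = k := by
      rw [Finset.card_image_of_injOn hR.2.injOn_snd, hR.1.2]
    have hle := Finset.card_le_card hsub
    rw [Finset.card_sdiff_of_subset hsub, Nat.cast_sub hle, hcard, Finset.card_range]
  have h4 : rookNumber (k + 1) D = (G (k + 1) C).card +
      ((G k C).sigma fun R => Finset.range L \ R.image Prod.snd).card := by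
    rw [h2, ← h1, Finset.card_filter_add_card_filter_not]
    rfl
  rw [h4, Finset.card_sigma]
  push_cast
  rw [Finset.sum_congr rfl h3, Finset.sum_const, nsmul_eq_mul, mul_comm ((G k C).card : ℤ)]
  rfl

/-- The board with rows `0, …, N - 1`, where row `i` consists of the columns `j < g i`. -/
def rowBoard (g : ℕ → ℕ) (N : ℕ) : Board :=
  (Finset.range N).biUnion fun i => {i} ×ˢ Finset.range (g i)

theorem mem_rowBoard {g : ℕ → ℕ} {N : ℕ} {c : ℕ × ℕ} :
    c ∈ rowBoard g N ↔ c.1 < N ∧ c.2 < g c.1 := by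
  simp only [rowBoard, Finset.mem_biUnion, Finset.mem_range, Finset.mem_product,
    Finset.mem_singleton]
  exact ⟨fun ⟨a, h1, h2, h3⟩ => by subst h2; exact ⟨h1, h3⟩, fun h => ⟨c.1, h.1, rfl, h.2⟩⟩

theorem rowBoard_succ (g : ℕ → ℕ) (N : ℕ) :
    rowBoard g (N + 1) = rowBoard g N ∪ {N} ×ˢ Finset.range (g N) := by
  rw [rowBoard, Finset.range_add_one, Finset.biUnion_insert, Finset.union_comm]
  rfl

theorem rookNumber_eq_zero_of_rows {B : Board} {N k : ℕ} (h : ∀ c ∈ B, c.1 < N) (hk : N < k) :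
    rookNumber k B = 0 := by
  rw [rookNumber, Finset.card_eq_zero, Finset.filter_eq_empty_iff]
  intro R hR hna
  rw [Finset.mem_powersetCard] at hR
  have h1 : R.image Prod.fst ⊆ Finset.range N := by
    intro b hb
    obtain ⟨c, hc, rfl⟩ := Finset.mem_image.1 hb
    exact Finset.mem_range.2 (h c (hR.1 hc))
  have h2 := Finset.card_le_card h1
  rw [Finset.card_image_of_injOn hna.injOn_fst, hR.2, Finset.card_range] at h2
  omega

/-- The factorial rook polynomial of a board with `N` rows. -/
noncomputable def factorialRookPolynomial (N : ℕ) (B : Board) : ℤ[X] :=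
  ∑ k ∈ Finset.range (N + 1), C (rookNumber k B : ℤ) * descPochhammer ℤ (N - k)

/-- The factorization theorem of Goldman, Joichi and White. -/
theorem factorialRookPolynomial_rowBoard {g : ℕ → ℕ} (hg : Monotone g) (N : ℕ) :
    factorialRookPolynomial N (rowBoard g N) =
      ∏ i ∈ Finset.range N, (X - C ((i : ℤ) - g i)) := by
  induction N with
  | zero => simp [factorialRookPolynomial, rookNumber_zero]
  | succ N ih =>
    rw [Finset.prod_range_succ, ← ih, rowBoard_succ]
    have hrow : ∀ c ∈ rowBoard g N, c.1 < N := fun c hc => (mem_rowBoard.1 hc).1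
    have hrec : ∀ k, (rookNumber (k + 1) (rowBoard g N ∪ {N} ×ˢ Finset.range (g N)) : ℤ) =
        rookNumber (k + 1) (rowBoard g N) + (g N - k) * rookNumber k (rowBoard g N) := fun k =>
      rookNumber_succ_union_row _ N (g N) k (fun c hc => (hrow c hc).ne)
        (fun c hc => (mem_rowBoard.1 hc).2.trans_le (hg (hrow c hc).le))
    -- The old board has only `N` rows, so its top term `r_{N+1}` vanishes when the sum is shifted
    -- by one.
    have h0 := rookNumber_eq_zero_of_rows hrow (Nat.lt_succ_self N)
    have h5 := Finset.sum_range_succ' (fun k => C (rookNumber k (rowBoard g N) : ℤ) *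
      descPochhammer ℤ (N + 1 - k)) (N + 1)
    rw [Finset.sum_range_succ, h0, Nat.cast_zero, C_0, zero_mul, add_zero, rookNumber_zero] at h5
    simp only [Nat.add_sub_add_right] at h5
    unfold factorialRookPolynomial
    rw [Finset.sum_range_succ', rookNumber_zero]
    simp_rw [hrec, Nat.add_sub_add_right, C_add, add_mul]
    rw [Finset.sum_add_distrib, add_right_comm, ← h5, ← Finset.sum_add_distrib, Finset.sum_mul]
    refine Finset.sum_congr rfl fun k hk => ?_
    have hk' : k ≤ N := Nat.lt_succ_iff.1 (Finset.mem_range.1 hk)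
    -- The falling factorial of degree `N + 1 - k` is the one of degree `N - k` times `X - (N - k)`;
    -- adding `g N - k` to this factor gives `X - (N - g N)`, independent of `k`.
    rw [Nat.succ_sub hk', Nat.succ_eq_add_one, descPochhammer_succ_right,
      ← Polynomial.C_eq_natCast, Nat.cast_sub hk']
    simp only [C_sub, C_mul]
    ring

/-- Falling factorials have distinct degrees, hence are linearly independent. The sums are reflected
so that the summation index is the degree. -/
theorem rookNumber_eq_of_factorialRookPolynomial_eq {N : ℕ} {B D : Board}
    (h : factorialRookPolynomial N B = factorialRookPolynomial N D) {k : ℕ} (hk : k ≤ N) :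
    rookNumber k B = rookNumber k D := by
  let S : Polynomial.Sequence ℤ :=
    ⟨descPochhammer ℤ, fun i => by
      rw [degree_eq_natDegree (monic_descPochhammer ℤ i).ne_zero, descPochhammer_natDegree]⟩
  have hS := linearIndependent_iff'.1 S.linearIndependent (Finset.range (N + 1))
    (fun i => (rookNumber (N - i) B : ℤ) - rookNumber (N - i) D) ?_ (N - k)
    (Finset.mem_range.2 (by omega))
  · rw [Nat.sub_sub_self hk, sub_eq_zero] at hS
    exact_mod_cast hS
  · unfold factorialRookPolynomial at h
    rw [← Finset.sum_range_reflect, ← Finset.sum_range_reflect (n := N + 1) (f := fun k =>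
      C (rookNumber k D : ℤ) * descPochhammer ℤ (N - k)), ← sub_eq_zero,
      ← Finset.sum_sub_distrib] at h
    rw [← h]
    refine Finset.sum_congr rfl fun i hi => ?_
    have hi' : i ≤ N := Nat.lt_succ_iff.1 (Finset.mem_range.1 hi)
    rw [show N + 1 - 1 - i = N - i by omega, Nat.sub_sub_self hi', ← sub_mul, ← C_sub,
      smul_eq_C_mul]

/-- The multiset of the row lengths of a Young diagram with at most `N` rows, the length of
row `i` being increased by `i`. -/
def shiftedRowLens (N : ℕ) (B : YoungDiagram) : Multiset ℕ :=
  (Multiset.range N).map fun i => B.rowLen i + i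

/-! ### Rook equivalence of Ferrers boards through row lengths -/

theorem cells_eq_image_rowBoard {B : YoungDiagram} {N : ℕ} (hN : B.rowLen N = 0) :
    B.cells = (rowBoard (fun i => B.rowLen (N - 1 - i)) N).image fun c => (N - 1 - c.1, c.2) := by
  ext ⟨a, b⟩
  simp only [Finset.mem_image, Prod.mk.injEq, Prod.exists, mem_rowBoard, YoungDiagram.mem_cells,
    YoungDiagram.mem_iff_lt_rowLen]
  constructor
  · intro h
    have ha : a < N := by
      by_contra hle
      have := B.rowLen_anti N a (not_lt.1 hle)
      omega
    exact ⟨N - 1 - a, b, ⟨by omega, by rwa [show N - 1 - (N - 1 - a) = a by omega]⟩, by omega, rfl⟩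
  · rintro ⟨i, j, ⟨hi, hj⟩, rfl, rfl⟩
    exact hj

/-- The factorization needs increasing rows, so the diagram is turned upside down: row `i` becomes
row `N - 1 - i` and yields the root `N - 1 - (rowLen i + i)`. -/
theorem factorialRookPolynomial_cells {B : YoungDiagram} {N : ℕ} (hN : B.rowLen N = 0) :
    factorialRookPolynomial N B.cells =
      (((shiftedRowLens N B).map fun v : ℕ => (N : ℤ) - 1 - v).map fun c => X - C c).prod := by
  have h1 : factorialRookPolynomial N B.cells =
      factorialRookPolynomial N (rowBoard (fun i => B.rowLen (N - 1 - i)) N) := by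
    unfold factorialRookPolynomial
    refine Finset.sum_congr rfl fun k _ => ?_
    rw [cells_eq_image_rowBoard hN,
      rookNumber_image _ (fun i => N - 1 - i) (fun j => j) _ fun c _ d _ e => e]
    · intro c hc d hd e
      have := (mem_rowBoard.1 hc).1
      have := (mem_rowBoard.1 hd).1
      omega
  rw [h1, factorialRookPolynomial_rowBoard fun i j hij => B.rowLen_anti _ _ (by omega),
    ← Finset.prod_range_reflect, shiftedRowLens, Multiset.map_map, Multiset.map_map,
    Finset.prod_eq_multiset_prod, Finset.range_val]
  congr 1
  refine Multiset.map_congr rfl fun i hi => ?_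
  rw [Multiset.mem_range] at hi
  simp only [Function.comp_apply]
  rw [show N - 1 - (N - 1 - i) = i by omega, Nat.sub_sub, Nat.cast_sub (by omega)]
  push_cast
  congr 2
  ring

theorem rookNumber_cells_eq_zero {B : YoungDiagram} {N k : ℕ} (hN : B.rowLen N = 0)
    (hk : N < k) : rookNumber k B.cells = 0 := by
  refine rookNumber_eq_zero_of_rows (fun c hc => ?_) hk
  have h1 : c.2 < B.rowLen c.1 := YoungDiagram.mem_iff_lt_rowLen.1 ((YoungDiagram.mem_cells _).1 hc)
  by_contra hle
  have := B.rowLen_anti N c.1 (not_lt.1 hle)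
  omega

/-- Rook equivalence of Ferrers boards in terms of their row lengths. -/
theorem rookEquivalent_cells_iff {B D : YoungDiagram} {N : ℕ} (hB : B.rowLen N = 0)
    (hD : D.rowLen N = 0) :
    RookEquivalent B.cells D.cells ↔ shiftedRowLens N B = shiftedRowLens N D := by
  constructor
  · intro h
    have h1 : factorialRookPolynomial N B.cells = factorialRookPolynomial N D.cells := by
      unfold factorialRookPolynomial
      exact Finset.sum_congr rfl fun k _ => by rw [h k]
    rw [factorialRookPolynomial_cells hB, factorialRookPolynomial_cells hD] at h1
    have h2 := congrArg roots h1
    rw [roots_multiset_prod_X_sub_C, roots_multiset_prod_X_sub_C] at h2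
    exact Multiset.map_injective (fun a b e => by simpa using e) h2
  · intro h k
    rcases le_or_gt k N with hk | hk
    · refine rookNumber_eq_of_factorialRookPolynomial_eq ?_ hk
      rw [factorialRookPolynomial_cells hB, factorialRookPolynomial_cells hD, h]
    · rw [rookNumber_cells_eq_zero hB hk, rookNumber_cells_eq_zero hD hk]


/-! ### Ferrers boards with distinct rows -/

theorem ext_rowLen {B D : YoungDiagram} (h : ∀ i, B.rowLen i = D.rowLen i) : B = D := by
  refine YoungDiagram.ext (Finset.ext fun c => ?_)
  rw [YoungDiagram.mem_cells, YoungDiagram.mem_cells]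
  exact YoungDiagram.mem_iff_lt_rowLen.trans ((h c.1) ▸ YoungDiagram.mem_iff_lt_rowLen.symm)

/-- The Young diagram with given row lengths. -/
def youngOfRowLen (f : ℕ → ℕ) (hf : Antitone f) (N : ℕ) : YoungDiagram where
  cells := rowBoard f N
  isLowerSet := by
    rintro ⟨a, b⟩ ⟨a', b'⟩ ⟨ha, hb⟩ hc
    simp only at ha hb
    rw [Finset.mem_coe, mem_rowBoard] at hc ⊢
    exact ⟨ha.trans_lt hc.1, hb.trans_lt (hc.2.trans_le (hf ha))⟩

theorem rowLen_youngOfRowLen {f : ℕ → ℕ} (hf : Antitone f) {N : ℕ} (hN : f N = 0) (i : ℕ) :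
    (youngOfRowLen f hf N).rowLen i = f i := by
  refine eq_of_forall_lt_iff fun j => ?_
  rw [← YoungDiagram.mem_iff_lt_rowLen, ← YoungDiagram.mem_cells]
  refine mem_rowBoard.trans ⟨fun h => h.2, fun h => ⟨?_, h⟩⟩
  by_contra hle
  have := hf (not_lt.1 hle)
  simp only at h this
  omega

theorem rowLen_pos_iff (B : YoungDiagram) (i : ℕ) : 0 < B.rowLen i ↔ i < B.colLen 0 := by
  rw [← YoungDiagram.mem_iff_lt_rowLen, YoungDiagram.mem_iff_lt_colLen]

theorem range_eq_add {m N : ℕ} (h : m ≤ N) :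
    Multiset.range N = Multiset.range m + (Multiset.range (N - m)).map (m + ·) := by
  obtain ⟨d, rfl⟩ := Nat.exists_eq_add_of_le h
  rw [Nat.add_sub_cancel_left, Multiset.range_add]

theorem shiftedRowLens_eq_add (B : YoungDiagram) {N m : ℕ} (hm : m ≤ N) (h : B.rowLen m = 0) :
    shiftedRowLens N B = (((List.range m).map fun i => B.rowLen i + i : List ℕ) : Multiset ℕ) +
      (Multiset.range (N - m)).map (m + ·) := by
  rw [shiftedRowLens, range_eq_add hm, Multiset.map_add, Multiset.map_map]
  congr 1
  refine Multiset.map_congr rfl fun i _ => ?_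
  have := B.rowLen_anti m (m + i) (Nat.le_add_right _ _)
  simp only [Function.comp_apply]
  omega

theorem DistinctRows.rowLen_lt {B : YoungDiagram} (hB : DistinctRows B) {i j : ℕ} (hij : i < j)
    (hi : 0 < B.rowLen i) : B.rowLen j < B.rowLen i :=
  lt_of_le_of_ne (B.rowLen_anti i j hij.le) fun e => hij.ne (hB i j hi e.symm)

/-- Each step down shortens a non-empty row by at least one, which compensates the growth of the
index. -/
theorem DistinctRows.rowLen_add_le {B : YoungDiagram} (hB : DistinctRows B) {i j : ℕ}
    (hij : i ≤ j) (hj : 0 < B.rowLen j) : B.rowLen j + j ≤ B.rowLen i + i := by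
  induction j, hij using Nat.le_induction with
  | base => exact le_rfl
  | succ j hij ih =>
    have h1 := B.rowLen_anti j (j + 1) (Nat.le_succ j)
    have h2 := hB.rowLen_lt (Nat.lt_add_one j) (hj.trans_le h1)
    have := ih (hj.trans_le h1)
    omega

/-- With `colLen_mem_shiftedRowLens`, this identifies the number of non-empty rows as the minimum of
the multiset, hence as a rook invariant. -/
theorem DistinctRows.colLen_le_of_mem {B : YoungDiagram} (hB : DistinctRows B) {N v : ℕ}
    (hv : v ∈ shiftedRowLens N B) : B.colLen 0 ≤ v := by
  obtain ⟨i, -, rfl⟩ := Multiset.mem_map.1 hv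
  rcases lt_or_ge i (B.colLen 0) with hi | hi
  · have h1 : 0 < B.rowLen (B.colLen 0 - 1) := (rowLen_pos_iff _ _).2 (by omega)
    have := hB.rowLen_add_le (show i ≤ B.colLen 0 - 1 by omega) h1
    omega
  · omega

theorem rowLen_colLen (B : YoungDiagram) : B.rowLen (B.colLen 0) = 0 := by
  by_contra h
  exact lt_irrefl _ ((rowLen_pos_iff B _).1 (Nat.pos_of_ne_zero h))

theorem colLen_mem_shiftedRowLens (B : YoungDiagram) {N : ℕ} (hN : B.colLen 0 < N) :
    B.colLen 0 ∈ shiftedRowLens N B :=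
  Multiset.mem_map.2 ⟨_, Multiset.mem_range.2 hN, by rw [rowLen_colLen, zero_add]⟩

theorem DistinctRows.eq_of_rookEquivalent {B D : YoungDiagram} (hB : DistinctRows B)
    (hD : DistinctRows D) (h : RookEquivalent B.cells D.cells) : B = D := by
  -- The summand `1` leaves an empty row below index `N` in both boards, so that both minima are
  -- attained.
  set N := B.colLen 0 + D.colLen 0 + 1 with hN
  have hzero : ∀ E : YoungDiagram, E.colLen 0 ≤ N → E.rowLen N = 0 := fun E hE => by
    have := E.rowLen_anti _ _ hE
    rw [rowLen_colLen] at this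
    omega
  rw [rookEquivalent_cells_iff (hzero B (by omega)) (hzero D (by omega))] at h
  have hcol : B.colLen 0 = D.colLen 0 := le_antisymm
    (hB.colLen_le_of_mem (h ▸ colLen_mem_shiftedRowLens D (by omega)))
    (hD.colLen_le_of_mem (h ▸ colLen_mem_shiftedRowLens B (by omega)))
  rw [shiftedRowLens_eq_add B (show B.colLen 0 ≤ N by omega) (rowLen_colLen B),
    shiftedRowLens_eq_add D (show D.colLen 0 ≤ N by omega) (rowLen_colLen D), ← hcol,
    add_left_inj, Multiset.coe_eq_coe] at h
  have hsort : ∀ E : YoungDiagram, DistinctRows E →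
      ((List.range (E.colLen 0)).map fun i => E.rowLen i + i).Pairwise (· ≥ ·) := by
    intro E hE
    rw [List.pairwise_map]
    refine List.pairwise_lt_range.imp_of_mem fun {i j} _ hj hij => ?_
    exact hE.rowLen_add_le hij.le ((rowLen_pos_iff _ _).2 (List.mem_range.1 hj))
  -- Both lists are sorted, so being permutations of each other they coincide.
  have h2 := h.eq_of_pairwise' (hsort B hB) (hcol ▸ hsort D hD)
  rw [List.map_inj_left] at h2
  refine ext_rowLen fun i => ?_
  rcases lt_or_ge i (B.colLen 0) with hi | hi
  · have := h2 i (List.mem_range.2 hi)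
    omega
  · have h3 := mt (rowLen_pos_iff B i).1 hi.not_gt
    have h4 := mt (rowLen_pos_iff D i).1 (hcol ▸ hi.not_gt)
    omega

/-- A sequence which increases by at most one in each step takes all values between its minimum
and a later value. -/
theorem exists_min_and_mem {a : ℕ → ℕ} {N : ℕ} (ha : ∀ i, a (i + 1) ≤ a i + 1)
    (hN : a N = N) (hi : ∀ i, i ≤ a i) :
    ∃ m ≤ N, (∀ i, m ≤ a i) ∧ ∀ v, m ≤ v → v < N → ∃ i < N, a i = v := by
  classical
  have hex : ∃ m, ∃ i, a i = m := ⟨_, 0, rfl⟩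
  refine ⟨Nat.find hex, Nat.find_le ⟨N, hN⟩, fun i => Nat.find_le ⟨i, rfl⟩, fun v hv hvN => ?_⟩
  obtain ⟨i₀, hi₀⟩ := Nat.find_spec hex
  have h0 : a i₀ ≤ v := hi₀ ▸ hv
  -- Just before the sequence first exceeds `v` after its minimum, it must equal `v`, since it rises
  -- by at most one.
  have hex' : ∃ d, v < a (i₀ + d) :=
    ⟨N, hvN.trans_le ((Nat.le_add_left _ _).trans (hi _))⟩
  obtain ⟨d, hd⟩ := Nat.exists_eq_succ_of_ne_zero (n := Nat.find hex') fun h => by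
    have := Nat.find_spec hex'
    rw [h, add_zero] at this
    omega
  have h1 := Nat.find_spec hex'
  have h2 := Nat.find_min hex' (m := d) (by omega)
  rw [hd, Nat.succ_eq_add_one, ← add_assoc] at h1
  have h3 := ha (i₀ + d)
  have h4 := hi (i₀ + d)
  exact ⟨i₀ + d, by omega, by omega⟩

theorem exists_distinctRows {B : YoungDiagram} {n : ℕ} (hn : B.rowLen n = 0)
    (hB : ∀ i, 0 < B.rowLen i → B.rowLen i + i < n) :
    ∃ D : YoungDiagram, DistinctRows D ∧ RookEquivalent D.cells B.cells ∧
      ∀ i, 0 < D.rowLen i → D.rowLen i + i < n := by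
  obtain ⟨m, hmn, hmin, hmem⟩ := exists_min_and_mem (a := fun i => B.rowLen i + i) (N := n)
    (fun i => by have := B.rowLen_anti i (i + 1) (Nat.le_succ i); omega)
    (by simp [hn]) (fun i => by omega)
  -- One copy of each of `m, …, n - 1` is reserved for the empty rows; the remainder `R` has `m`
  -- elements, one for each row to be built.
  have hle : (Multiset.range (n - m)).map (m + ·) ≤ shiftedRowLens n B := by
    rw [Multiset.le_iff_subset ((Multiset.nodup_range _).map (add_right_injective m))]
    intro v hv
    obtain ⟨i, hi, rfl⟩ := Multiset.mem_map.1 hv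
    rw [Multiset.mem_range] at hi
    obtain ⟨j, hj, e⟩ := hmem (m + i) (Nat.le_add_right _ _) (by omega)
    exact Multiset.mem_map.2 ⟨j, Multiset.mem_range.2 hj, e⟩
  obtain ⟨R, hR⟩ := Multiset.le_iff_exists_add.1 hle
  have hRcard : R.card = m := by
    have := congrArg Multiset.card hR
    simp [shiftedRowLens] at this
    omega
  have hRmem : ∀ v ∈ R, m ≤ v ∧ v < n := by
    intro v hv
    have hv' : v ∈ shiftedRowLens n B := hR ▸ Multiset.mem_add.2 (Or.inr hv)
    obtain ⟨i, hi, rfl⟩ := Multiset.mem_map.1 hv'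
    rw [Multiset.mem_range] at hi
    refine ⟨hmin i, ?_⟩
    rcases Nat.eq_zero_or_pos (B.rowLen i) with h | h
    · omega
    · exact hB i h
  set l := R.sort (· ≥ ·) with hl
  have hlR : (l : Multiset ℕ) = R := Multiset.sort_eq R _
  have hlen : l.length = m := by rw [← hRcard, ← hlR, Multiset.coe_card]
  have hlmem : ∀ i (hi : i < l.length), m ≤ l[i] ∧ l[i] < n := fun i hi =>
    hRmem _ (hlR ▸ List.getElem_mem hi)
  have hsort : l.Pairwise (· ≥ ·) := Multiset.pairwise_sort R _
  -- For `i < m` one has `l[i] ≥ m > i`, so nothing is truncated and the row is non-empty; for `i ≥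
  -- m` the default `0` gives an empty row.
  let f : ℕ → ℕ := fun i => l.getD i 0 - i
  have hf1 : ∀ i (hi : i < l.length), f i = l[i] - i := fun i hi => by
    simp [f, hi]
  have hf0 : ∀ i, m ≤ i → f i = 0 := fun i hi => by
    have : l.length ≤ i := hlen ▸ hi
    simp [f, this]
  have hlt : ∀ i j, i < j → j < m → f j < f i := fun i j hij hj => by
    have h1 := List.pairwise_iff_getElem.1 hsort i j (by omega) (by omega) hij
    have h2 := hlmem j (by omega)
    rw [hf1 i (by omega), hf1 j (by omega)]
    omega
  have hanti : Antitone f := fun i j hij => by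
    rcases lt_or_ge j m with hj | hj
    · rcases hij.lt_or_eq with h | rfl
      · exact (hlt i j h hj).le
      · exact le_rfl
    · rw [hf0 j hj]; exact Nat.zero_le _
  have hrow : ∀ i, (youngOfRowLen f hanti n).rowLen i = f i :=
    rowLen_youngOfRowLen hanti (hf0 n hmn)
  have hpos : ∀ i, 0 < f i → i < m := fun i h => by
    by_contra hle
    exact h.ne' (hf0 i (not_lt.1 hle))
  refine ⟨youngOfRowLen f hanti n, ?_, ?_, ?_⟩
  · intro i j hi e
    rw [hrow] at hi e
    rw [hrow] at e
    have h1 := hpos i hi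
    have h2 := hpos j (e ▸ hi)
    rcases lt_trichotomy i j with h | h | h
    · exact absurd e (hlt i j h h2).ne'
    · exact h
    · exact absurd e (hlt j i h h1).ne
  · rw [rookEquivalent_cells_iff ((hrow n).trans (hf0 n hmn)) hn,
      shiftedRowLens_eq_add _ hmn ((hrow m).trans (hf0 m le_rfl)), hR, add_comm]
    congr 1
    rw [← hlR, Multiset.coe_eq_coe]
    refine List.Perm.of_eq (List.ext_getElem (by simp [hlen]) fun i h1 h2 => ?_)
    have := hlmem i h2
    rw [List.getElem_map, List.getElem_range, hrow, hf1 i h2]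
    omega
  · intro i hi
    rw [hrow] at hi ⊢
    have h1 := hpos i hi
    have h2 := hlmem i (by omega)
    rw [hf1 i (by omega)]
    omega

/-! ### The Ferrers board of `(X, Y)` -/

/-- The staircase bound: for a square `(i, j)` with `j < i`, at most `n - i` rows lie below it and
at most `j - 1` columns to its left. -/
theorem lt_of_mem_ferrersBoard {n : ℕ} {X Y : Set ℕ} {a b : ℕ}
    (h : (a, b) ∈ ferrersBoard n X Y) : a + b + 1 < n := by
  rw [← YoungDiagram.mem_cells] at h
  obtain ⟨⟨i, j⟩, hij, e⟩ := Finset.mem_image.1 (show (a, b) ∈ shiftToCorner _ from h)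
  rw [Prod.mk.injEq] at e
  have h1 : a ≤ (Finset.Ioc i n).card := by
    rw [← e.1]
    refine Finset.card_le_card fun x hx => ?_
    rw [Finset.mem_filter, Finset.mem_image] at hx
    obtain ⟨⟨c, hc, rfl⟩, hlt⟩ := hx
    exact Finset.mem_Ioc.2 ⟨hlt, (mem_descentBoard.1 hc).1.1.2⟩
  have h2 : b ≤ (Finset.Ico 1 j).card := by
    rw [← e.2]
    refine Finset.card_le_card fun x hx => ?_
    rw [Finset.mem_filter, Finset.mem_image] at hx
    obtain ⟨⟨c, hc, rfl⟩, hlt⟩ := hx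
    exact Finset.mem_Ico.2 ⟨(mem_descentBoard.1 hc).1.2.1, hlt⟩
  rw [Nat.card_Ioc] at h1
  rw [Nat.card_Ico] at h2
  have := mem_descentBoard.1 hij
  simp only at this
  omega

theorem rowLen_add_lt_ferrersBoard {n : ℕ} {X Y : Set ℕ} (i : ℕ)
    (h : 0 < (ferrersBoard n X Y).rowLen i) : (ferrersBoard n X Y).rowLen i + i < n := by
  have := lt_of_mem_ferrersBoard (n := n) (X := X) (Y := Y) (a := i)
    (b := (ferrersBoard n X Y).rowLen i - 1) (YoungDiagram.mem_iff_lt_rowLen.2 (by omega))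
  omega

theorem rowLen_ferrersBoard_self (n : ℕ) (X Y : Set ℕ) : (ferrersBoard n X Y).rowLen n = 0 := by
  by_contra h
  have := rowLen_add_lt_ferrersBoard n (Nat.pos_of_ne_zero h)
  omega

theorem fits_of_rowLen_add_lt {n : ℕ} {B : YoungDiagram}
    (h : ∀ i, 0 < B.rowLen i → B.rowLen i + i < n) : Fits n B := by
  rintro ⟨a, b⟩ hc
  rw [YoungDiagram.mem_cells, YoungDiagram.mem_iff_lt_rowLen] at hc
  have := h a (by omega)
  rw [Finset.mem_product, Finset.mem_range, Finset.mem_range]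
  constructor <;> simp only <;> omega

theorem eq_of_card_filter_gt_eq {S : Finset ℕ} {x y : ℕ} (hx : x ∈ S) (hy : y ∈ S)
    (h : (S.filter fun i => x < i).card = (S.filter fun i => y < i).card) : x = y := by
  have key : ∀ {x y : ℕ}, y ∈ S → x < y →
      (S.filter fun i => y < i).card < (S.filter fun i => x < i).card := by
    intro x y hy hxy
    refine Finset.card_lt_card (Finset.ssubset_iff_of_subset ?_ |>.2 ⟨y, ?_, ?_⟩)
    · exact Finset.monotone_filter_right _ fun i _ hi => hxy.trans hi
    · exact Finset.mem_filter.2 ⟨hy, hxy⟩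
    · simp
  rcases lt_trichotomy x y with h' | h' | h'
  · exact absurd h (key hy h').ne'
  · exact h'
  · exact absurd h (key hx h').ne

theorem eq_of_card_filter_lt_eq {S : Finset ℕ} {x y : ℕ} (hx : x ∈ S) (hy : y ∈ S)
    (h : (S.filter fun i => i < x).card = (S.filter fun i => i < y).card) : x = y := by
  have key : ∀ {x y : ℕ}, x ∈ S → x < y →
      (S.filter fun i => i < x).card < (S.filter fun i => i < y).card := by
    intro x y hx hxy
    refine Finset.card_lt_card (Finset.ssubset_iff_of_subset ?_ |>.2 ⟨x, ?_, ?_⟩)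
    · exact Finset.monotone_filter_right _ fun i _ hi => lt_trans hi hxy
    · exact Finset.mem_filter.2 ⟨hx, hxy⟩
    · simp
  rcases lt_trichotomy x y with h' | h' | h'
  · exact absurd h (key hx h').ne
  · exact h'
  · exact absurd h (key hy h').ne'

/-- Closing the gaps relabels non-empty rows and non-empty columns injectively. -/
theorem rookEquivalent_ferrersBoard (n : ℕ) (X Y : Set ℕ) :
    RookEquivalent (descentBoard n X Y) (ferrersBoard n X Y).cells := by
  intro k
  set B := descentBoard n X Y
  refine (rookNumber_image B (fun i => ((B.image Prod.fst).filter fun x => i < x).card)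
    (fun j => ((B.image Prod.snd).filter fun x => x < j).card) ?_ ?_ k).symm
  · exact fun c hc d hd e => eq_of_card_filter_gt_eq (Finset.mem_image_of_mem Prod.fst hc)
      (Finset.mem_image_of_mem Prod.fst hd) e
  · exact fun c hc d hd e => eq_of_card_filter_lt_eq (Finset.mem_image_of_mem Prod.snd hc)
      (Finset.mem_image_of_mem Prod.snd hd) e

theorem inSquare_subset_square {n : ℕ} {B : YoungDiagram} (h : Fits n B) :
    inSquare n B ⊆ square n := by
  intro c hc
  obtain ⟨d, hd, rfl⟩ := Finset.mem_image.1 hc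
  have := h hd
  simp only [square, Finset.mem_product, Finset.mem_range, Finset.mem_Icc] at this ⊢
  omega

theorem rookEquivalent_inSquare {n : ℕ} {B : YoungDiagram} (h : Fits n B) :
    RookEquivalent (inSquare n B) B.cells := by
  intro k
  refine rookNumber_image B.cells (fun i => n - i) (fun j => n - j) ?_ ?_ k <;>
  · intro c hc d hd e
    have h1 := h hc
    have h2 := h hd
    simp only [Finset.mem_product, Finset.mem_range] at h1 h2 e
    omega

theorem descentBoard_subset_square (n : ℕ) (X Y : Set ℕ) : descentBoard n X Y ⊆ square n := by
  classical exact Finset.filter_subset _ _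

theorem fits_ferrersBoard (n : ℕ) (X Y : Set ℕ) : Fits n (ferrersBoard n X Y) :=
  fits_of_rowLen_add_lt rowLen_add_lt_ferrersBoard

/-! ### Descent numbers as hit numbers -/

theorem P_eq_hitNumber_descentBoard (n s : ℕ) (X Y : Set ℕ) :
    P n s X Y = hitNumber n s (descentBoard n X Y) := by
  classical
  obtain ⟨Φ, hΦ⟩ := exists_foata n
  rw [hitNumber_eq_card_perm, P]
  symm
  refine Finset.card_equiv Φ fun ω => ?_
  simp only [Finset.mem_filter, Finset.mem_univ, true_and]
  rw [desXY_eq_card_of_isDescentPair_iff (isDescentPair_iff_of_ofFn_eq (hΦ ω))]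

theorem P_eq_hitNumber_inSquare {n : ℕ} {X Y : Set ℕ} {B : YoungDiagram} (hB : Fits n B)
    (h : RookEquivalent B.cells (ferrersBoard n X Y).cells) (s : ℕ) :
    P n s X Y = hitNumber n s (inSquare n B) := by
  rw [P_eq_hitNumber_descentBoard]
  refine RookEquivalent.hitNumber_eq (fun k => ?_) (descentBoard_subset_square n X Y)
    (inSquare_subset_square hB) s
  rw [rookEquivalent_ferrersBoard n X Y k, ← h k, rookEquivalent_inSquare hB k]

/-! ### The Ferrers board of a set `X` -/

/-- Each `x ∈ X` gives the non-empty row `1, …, x - 1`. The columns have no gaps, so only the rows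
are shifted; `S` is `X` as a `Finset`. -/
theorem mem_ferrersBoard_univ {n : ℕ} {X : Set ℕ} {S : Finset ℕ} (hX : X ⊆ Set.Icc 2 n)
    (hS : ∀ x, x ∈ S ↔ x ∈ X) {a b : ℕ} :
    (a, b) ∈ ferrersBoard n X Set.univ ↔
      ∃ x ∈ S, (S.filter fun y => x < y).card = a ∧ b + 1 < x := by
  have hmem : ∀ i j, (i, j) ∈ descentBoard n X Set.univ ↔ i ∈ X ∧ 1 ≤ j ∧ j < i := by
    intro i j
    rw [mem_descentBoard]
    constructor
    · rintro ⟨h1, h2, -, h3⟩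
      exact ⟨h2, h1.2.1, h3⟩
    · rintro ⟨h1, h2, h3⟩
      have := hX h1
      rw [Set.mem_Icc] at this
      simp only at *
      exact ⟨by omega, h1, Set.mem_univ _, h3⟩
  have hrows : (descentBoard n X Set.univ).image Prod.fst = S := by
    ext i
    rw [Finset.mem_image, hS]
    constructor
    · rintro ⟨⟨i', j⟩, h, rfl⟩
      exact ((hmem i' j).1 h).1
    · intro h
      have := (hX h).1
      exact ⟨(i, 1), (hmem i 1).2 ⟨h, le_rfl, by omega⟩, rfl⟩
  have hcols : ∀ i j, (i, j) ∈ descentBoard n X Set.univ →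
      (((descentBoard n X Set.univ).image Prod.snd).filter fun y => y < j).card = j - 1 := by
    intro i j h
    rw [← Nat.card_Ico]
    congr 1
    ext y
    rw [Finset.mem_filter, Finset.mem_image, Finset.mem_Ico]
    constructor
    · rintro ⟨⟨⟨i', j'⟩, h', rfl⟩, hlt⟩
      exact ⟨((hmem i' j').1 h').2.1, hlt⟩
    · rintro ⟨h1, h2⟩
      have h3 := (hmem i j).1 h
      exact ⟨⟨(i, y), (hmem i y).2 ⟨h3.1, h1, h2.trans h3.2.2⟩, rfl⟩, h2⟩
  rw [← YoungDiagram.mem_cells]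
  change (a, b) ∈ shiftToCorner (descentBoard n X Set.univ) ↔ _
  rw [shiftToCorner, hrows, Finset.mem_image]
  constructor
  · rintro ⟨⟨i, j⟩, h, e⟩
    rw [Prod.mk.injEq, hcols i j h] at e
    have h1 := (hmem i j).1 h
    exact ⟨i, (hS i).2 h1.1, e.1, by omega⟩
  · rintro ⟨x, hx, rfl, hb⟩
    have h1 := (hmem x (b + 1)).2 ⟨(hS x).1 hx, by omega, hb⟩
    exact ⟨(x, b + 1), h1, by rw [hcols x _ h1]; rfl⟩

theorem mem_iff_exists_rowLen_ferrersBoard {n : ℕ} {X : Set ℕ} (hX : X ⊆ Set.Icc 2 n) (x : ℕ) :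
    x ∈ X ↔ ∃ a, 0 < (ferrersBoard n X Set.univ).rowLen a ∧
      (ferrersBoard n X Set.univ).rowLen a + 1 = x := by
  have hfin : X.Finite := (Set.finite_Icc 2 n).subset hX
  set S := hfin.toFinset with hSdef
  have hS : ∀ x, x ∈ S ↔ x ∈ X := fun x => hfin.mem_toFinset
  have hrow : ∀ x ∈ S, (ferrersBoard n X Set.univ).rowLen (S.filter fun y => x < y).card + 1 = x := by
    intro x hx
    have h2 := (hX ((hS x).1 hx)).1
    suffices h : (ferrersBoard n X Set.univ).rowLen (S.filter fun y => x < y).card = x - 1 by omega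
    refine eq_of_forall_lt_iff fun j => ?_
    rw [← YoungDiagram.mem_iff_lt_rowLen, mem_ferrersBoard_univ hX hS]
    constructor
    · rintro ⟨y, hy, e, hj⟩
      rw [eq_of_card_filter_gt_eq hy hx e] at hj
      omega
    · intro hj
      exact ⟨x, hx, rfl, by omega⟩
  constructor
  · intro hx
    have h1 := hrow x ((hS x).2 hx)
    have h2 := (hX hx).1
    exact ⟨_, by omega, h1⟩
  · rintro ⟨a, ha, rfl⟩
    obtain ⟨x, hx, rfl, -⟩ := (mem_ferrersBoard_univ hX hS).1 (YoungDiagram.mem_iff_lt_rowLen.2 ha)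
    rw [hrow x hx]
    exact (hS x).1 hx

/-- An element `x` produces a row of length `x - 1`, so `X` has to consist of the non-empty row
lengths plus one; the bound keeps these at most `n`. -/
theorem existsUnique_set_ferrersBoard_eq {n : ℕ} {B : YoungDiagram} (hB : DistinctRows B)
    (h : ∀ i, 0 < B.rowLen i → B.rowLen i + i < n) :
    ∃! X : Set ℕ, X ⊆ Set.Icc 2 n ∧ ferrersBoard n X Set.univ = B := by
  refine ⟨{x | ∃ i, 0 < B.rowLen i ∧ B.rowLen i + 1 = x}, ⟨?_, ?_⟩, ?_⟩
  · rintro x ⟨i, hi, rfl⟩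
    have := h i hi
    exact ⟨by omega, by omega⟩
  · have hX : {x | ∃ i, 0 < B.rowLen i ∧ B.rowLen i + 1 = x} ⊆ Set.Icc 2 n := by
      rintro x ⟨i, hi, rfl⟩
      have := h i hi
      exact ⟨by omega, by omega⟩
    set S := (Finset.range (B.colLen 0)).image fun i => B.rowLen i + 1 with hSdef
    have hS : ∀ x, x ∈ S ↔ x ∈ {x | ∃ i, 0 < B.rowLen i ∧ B.rowLen i + 1 = x} := by
      intro x
      simp [hSdef, rowLen_pos_iff]
    -- Distinctness enters here: exactly the `i` rows preceding row `i` are longer, so its element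
    -- is shifted back to row `i`.
    have hcard : ∀ i, 0 < B.rowLen i → (S.filter fun y => B.rowLen i + 1 < y).card = i := by
      intro i hi
      have hinj : Set.InjOn (fun j => B.rowLen j + 1) (Finset.range i : Set ℕ) := by
        intro j hj k _ e
        have h1 := B.rowLen_anti j i (Finset.mem_range.1 hj).le
        exact hB j k (by omega) (by simpa using e)
      have : (S.filter fun y => B.rowLen i + 1 < y) =
          (Finset.range i).image fun j => B.rowLen j + 1 := by
        ext y
        rw [Finset.mem_filter, hS, Finset.mem_image]
        constructor
        · rintro ⟨⟨j, hj, rfl⟩, hlt⟩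
          refine ⟨j, Finset.mem_range.2 ?_, rfl⟩
          by_contra hle
          have := B.rowLen_anti i j (not_lt.1 hle)
          omega
        · rintro ⟨j, hj, rfl⟩
          have hj' := Finset.mem_range.1 hj
          have h1 := B.rowLen_anti j i hj'.le
          have h2 := hB.rowLen_lt hj' (by omega)
          exact ⟨⟨j, by omega, rfl⟩, by omega⟩
      rw [this, Finset.card_image_of_injOn hinj, Finset.card_range]
    refine YoungDiagram.ext (Finset.ext fun c => ?_)
    obtain ⟨a, b⟩ := c
    rw [YoungDiagram.mem_cells, YoungDiagram.mem_cells, mem_ferrersBoard_univ hX hS,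
      YoungDiagram.mem_iff_lt_rowLen]
    constructor
    · rintro ⟨x, hx, e, hb⟩
      obtain ⟨i, hi, rfl⟩ := (hS x).1 hx
      rw [hcard i hi] at e
      subst e
      omega
    · intro hb
      have ha : 0 < B.rowLen a := by omega
      exact ⟨B.rowLen a + 1, (hS _).2 ⟨a, ha, rfl⟩, hcard a ha, by omega⟩
  · rintro X ⟨hX, rfl⟩
    ext x
    exact mem_iff_exists_rowLen_ferrersBoard hX x

end DescentRook

open DescentRook in
theorem mainTheorem4 (n : ℕ) (X Y : Set ℕ) :
    -- Foata's first transformation is a bijection that sends excedences to descents,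
    -- and thereby rooks on the board of potential descent pairs to descents
    (∃ Φ : Equiv.Perm (Fin n) ≃ Equiv.Perm (Fin n),
      (∀ ω, List.ofFn (Φ ω) = DescentRook.foataWord ω) ∧
      (∀ ω, ∀ a b : Fin n, DescentRook.IsDescentPair (Φ ω) a b ↔ b < a ∧ ω b = a) ∧
      (∀ ω, DescentRook.desXY X Y (Φ ω) =
        (DescentRook.rooks ω ∩ DescentRook.descentBoard n X Y).card)) ∧
    -- the numbers `P` are hit numbers of that board and of the corresponding Ferrers board
    (∀ s : ℕ, DescentRook.P n s X Y =
      DescentRook.hitNumber n s (DescentRook.descentBoard n X Y)) ∧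
    DescentRook.Fits n (DescentRook.ferrersBoard n X Y) ∧
    DescentRook.RookEquivalent (DescentRook.descentBoard n X Y)
      (DescentRook.ferrersBoard n X Y).cells ∧
    (∀ s : ℕ, DescentRook.P n s X Y =
      DescentRook.hitNumber n s (DescentRook.inSquare n (DescentRook.ferrersBoard n X Y))) ∧
    -- there is a unique rook-equivalent Ferrers board `B'` with distinct rows
    (∃! B' : YoungDiagram, DescentRook.DistinctRows B' ∧
      DescentRook.RookEquivalent B'.cells (DescentRook.ferrersBoard n X Y).cells) ∧
    ∀ B' : YoungDiagram, DescentRook.DistinctRows B' →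
      DescentRook.RookEquivalent B'.cells (DescentRook.ferrersBoard n X Y).cells →
      DescentRook.Fits n B' ∧
      (∀ s : ℕ, DescentRook.P n s X Y =
        DescentRook.hitNumber n s (DescentRook.inSquare n B')) ∧
      -- `B'` is the board of a set `X' ⊆ [n]`, which is unique up to the element `1`
      (∃! X' : Set ℕ, X' ⊆ Set.Icc 2 n ∧ DescentRook.ferrersBoard n X' Set.univ = B') ∧
      ∀ X' : Set ℕ, X' ⊆ Set.Icc 1 n → DescentRook.ferrersBoard n X' Set.univ = B' →
        ∀ s : ℕ, DescentRook.P n s X' Set.univ =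
            DescentRook.hitNumber n s (DescentRook.inSquare n B') ∧
          DescentRook.P n s X Y = DescentRook.P n s X' Set.univ := by
  obtain ⟨D, hD, hDB, hDn⟩ :=
    exists_distinctRows (rowLen_ferrersBoard_self n X Y) rowLen_add_lt_ferrersBoard
  have huniq : ∀ B : YoungDiagram, DistinctRows B →
      RookEquivalent B.cells (ferrersBoard n X Y).cells → B = D := fun B hB h =>
    hB.eq_of_rookEquivalent hD fun k => (h k).trans (hDB k).symm
  have hfit : Fits n D := fits_of_rowLen_add_lt hDn
  refine ⟨?_, fun s => P_eq_hitNumber_descentBoard n s X Y, fits_ferrersBoard n X Y,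
    rookEquivalent_ferrersBoard n X Y,
    P_eq_hitNumber_inSquare (fits_ferrersBoard n X Y) fun _ => rfl,
    ⟨D, ⟨hD, hDB⟩, fun B hB => huniq B hB.1 hB.2⟩, ?_⟩
  · obtain ⟨Φ, hΦ⟩ := exists_foata n
    exact ⟨Φ, hΦ, fun ω => isDescentPair_iff_of_ofFn_eq (hΦ ω), fun ω =>
      desXY_eq_card_of_isDescentPair_iff (isDescentPair_iff_of_ofFn_eq (hΦ ω)) X Y⟩
  · intro B hB h
    obtain rfl := huniq B hB h
    refine ⟨hfit, P_eq_hitNumber_inSquare hfit h, existsUnique_set_ferrersBoard_eq hB hDn, ?_⟩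
    intro X' _ hX' s
    -- The hit number formula is applied to the pair `(X', ℕ)`, whose Ferrers board is `B` itself.
    have h1 : P n s X' Set.univ = hitNumber n s (inSquare n B) :=
      P_eq_hitNumber_inSquare hfit (fun k => by rw [hX']) s
    exact ⟨h1, (P_eq_hitNumber_inSquare hfit h s).trans h1.symm⟩
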